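/- **Setting.** Let $A\in\mathbb{R}^{m\times n}$ ($m,n\ge 1$) have $N=\mathrm{nnz}(A)$ nonzero entries, with $m+n\le 2N$ (for instance, no zero row or column). Consider $$\min_{x\in\mathcal X}\max_{y\in\mathcal Y} f(x,y),\qquad f(x,y)=y^\top Ax+\phi(x)-\psi(y),$$ in one of three setups: $\ell_1$-$\ell_1$ ($\mathcal X=\Delta^n$, $\mathcal Y=\Delta^m$), $\ell_2$-$\ell_1$ ($\mathcal X=\mathbb B^n$, $\mathcal Y=\Delta^m$), $\ell_2$-$\ell_2$ ($\mathcal X=\mathbb B^n$, $\mathcal Y=\mathbb B^m$). Here $\Delta^d$ is the probability simplex, with norm $\|\cdot\|_1$ and $r(v)=\sum_i v_i\log v_i$, and $\mathbb B^d$ is the Euclidean unit ball, with norm $\|\cdot\|_2$ and $r(v)=\frac12\|v\|_2^2$. Write $r^{\mathsf x},r^{\mathsf y}$ for the functions $r$ on the two blocks, $V_v(v')=r(v')-r(v)-\langle\nabla r(v),v'-v\rangle$ for the Bregman divergence, and $\|(x,y)\|^2=\|x\|^2+\|y\|^2$. Put - $\ell_1$-$\ell_1$: $L=\max_{i,j}|A_{ij}|$,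 $\Theta=\log(mn)$; - $\ell_2$-$\ell_1$: $L=\max_i\|A_{i:}\|_2$, $\Theta=\log(2m)$; - $\ell_2$-$\ell_2$: $L=\|A\|_{\mathrm F}$, $\Theta=1$. **Assumptions.** $\phi$ and $\psi$ are continuous, and differentiable relative to the domain (in the relative interior for a simplex, on the whole closed ball for a ball). For constants $\mu^{\mathsf x},\mu^{\mathsf y},B>0$: 1. $\phi-\mu^{\mathsf x}r^{\mathsf x}$ and $\psi-\mu^{\mathsf y}r^{\mathsf y}$ are convex; 2. $x\mapsto\langle\nabla\phi(x),x-u\rangle$ and $y\mapsto\langle\nabla\psi(y),y-v\rangle$ are convex for all $u\in\mathcal X$, $v\in\mathcal Y$; 3. if $(x^\star,y^\star)$ is a saddle point of $f$, then $\phi(x)+\psi(y)-\phi(x^\star)-\psi(y^\star)\le B\,\|(x,y)-(x^\star,y^\star)\|$ on $\mathcal X\times\mathcal Y$ (this holds if $\|(\nabla\phi(x),\nabla\psi(y))\|_*\le B$ everywhere). **Algorithm.** Let $\mu=\sqrt{\mu^{\mathsf x}\mu^{\mathsf y}}$, $\rho=\sqrt{\mu^{\mathsf x}/\mu^{\mathsf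 y}}$ and $g(x,y)=(A^\top y,-Ax)$. The parameters are $\alpha,\eta>0$ and integers $T\ge1$, $K\ge0$. Let $z_0$ be the minimizer of $r^{\mathsf x}+r^{\mathsf y}$. For $k=1,\dots,K$, put $w_0=z_{k-1}$ and, for $t=1,\dots,T$, set $$w_t^{\mathsf x}=\arg\min_{x\in\mathcal X}\Big\{\langle\tilde g^{\mathsf x},x\rangle+\phi(x)+\tfrac{\alpha\rho}{2}V_{w_0^{\mathsf x}}(x)+\tfrac{\rho}{\eta}V_{w_{t-1}^{\mathsf x}}(x)\Big\},\qquad w_t^{\mathsf y}=\arg\min_{y\in\mathcal Y}\Big\{\langle\tilde g^{\mathsf y},y\rangle+\psi(y)+\tfrac{\alpha}{2\rho}V_{w_0^{\mathsf y}}(y)+\tfrac{1}{\eta\rho}V_{w_{t-1}^{\mathsf y}}(y)\Big\}.$$ Here, with $w=w_{t-1}$ and independent random indices $i\sim p$, $j\sim q$, $$\tilde g=\Big(A^\top w_0^{\mathsf y}+A_{i:}\frac{[w^{\mathsf y}-w_0^{\mathsf y}]_i}{p_i},\ -Aw_0^{\mathsf x}-\mathrm{trunc}_\tau\Big(A_{:j}\frac{[w^{\mathsf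 x}-w_0^{\mathsf x}]_j}{q_j}\Big)\Big).$$ In each block the sampling probabilities are proportional to the absolute values (simplex) or the squares (ball) of the entries of $w-w_0$ in that block. If these entries all vanish, the index is uniform, and the correction term is $0$. The map $\mathrm{trunc}_\tau$ clips entries to $[-\tau,\tau]$ with $\tau=1/(\eta\rho)$ in the $\ell_2$-$\ell_1$ setup, and is the identity in the other two. Put $z_{k-1/2}=\frac1T\sum_{t=1}^T w_t$ and $$z_k^{\mathsf x}=\arg\min_{x\in\mathcal X}\Big\{\langle g^{\mathsf x}(z_{k-1/2})+\nabla\phi(z_{k-1/2}^{\mathsf x}),x\rangle+\alpha\rho V_{z_{k-1}^{\mathsf x}}(x)+\mu\rho V_{z_{k-1/2}^{\mathsf x}}(x)\Big\},$$ $$z_k^{\mathsf y}=\arg\min_{y\in\mathcal Y}\Big\{\langle g^{\mathsf y}(z_{k-1/2})+\nabla\psi(z_{k-1/2}^{\mathsf y}),y\rangle+\tfrac{\alpha}{\rho}V_{z_{k-1}^{\mathsf y}}(y)+\tfrac{\mu}{\rho}V_{z_{k-1/2}^{\mathsf y}}(y)\Big\}.$$ The output is $z=z_K$. **Time.** Each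 arithmetic operation and each entry written costs $1$. Sampling one of $d$ indices with given weights, evaluating $\nabla\phi$ or $\nabla\psi$ in dimension $d$, and each of the $\arg\min$ steps above in dimension $d$ cost $d$. Products with $A$ and $A^\top$ run over the nonzero entries. **Claim.** There is a universal constant $C$, and a rule choosing $\alpha,\eta,T,K$ from the setup and $n,m,N,L,\mu^{\mathsf x},\mu^{\mathsf y},B,\epsilon$ only, such that for every such problem and every $\epsilon>0$ the output satisfies $z\in\mathcal X\times\mathcal Y$ and $$\mathbb E\,\mathrm{Gap}(z)\le\epsilon,\qquad \mathrm{Gap}(z)=\max_{y'\in\mathcal Y}f(z^{\mathsf x},y')-\min_{x'\in\mathcal X}f(x',z^{\mathsf y}).$$ Moreover, with $$X=\sqrt{N(m+n)}\,\frac{L}{\sqrt{\mu^{\mathsf x}\mu^{\mathsf y}}},\qquad \hat\Theta=\Big(\sqrt{\mu^{\mathsf x}/\mu^{\mathsf y}}+\sqrt{\mu^{\mathsf y}/\mu^{\mathsf x}}\Big)^2\Theta,\qquad \ell=\max\Big\{1,\log\frac{(B+L)\sqrt{\hat\Theta}}{\epsilon}\Big\}$$ (and $\ell=1$ if $\hat\Theta=0$),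 the worst-case running time, over all random outcomes, is at most $$C\Big(N+\frac{N}{\log(1+N/X)}\,\ell\Big).$$ If $X\ge N$, i.e. $\sqrt{\mu^{\mathsf x}\mu^{\mathsf y}}\le L\sqrt{(m+n)/N}$, it is at most $$C\,(N+X\,\ell)=O\Big(\mathrm{nnz}(A)+\sqrt{\mathrm{nnz}(A)(m+n)}\,\frac{L}{\sqrt{\mu^{\mathsf x}\mu^{\mathsf y}}}\,\ell\Big).$$ -/

import Mathlib

noncomputable section

namespace SaddleVR

/-! ## Cost model: randomized real-number programs with a step count -/

/-- Arithmetic expressions over real registers. -/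
inductive RealExpr : Type
  | val (x : ℝ)
  | add (a b : RealExpr)
  | sub (a b : RealExpr)
  | mul (a b : RealExpr)
  | div (a b : RealExpr)
  | max (a b : RealExpr)
  | min (a b : RealExpr)
  | abs (a : RealExpr)
  | neg (a : RealExpr)

namespace RealExpr

/-- The real number an expression evaluates to. -/
def eval : RealExpr → ℝ
  | val x => x
  | add a b => a.eval + b.eval
  | sub a b => a.eval - b.eval
  | mul a b => a.eval * b.eval
  | div a b => a.eval / b.eval
  | max a b => Max.max a.eval b.eval
  | min a b => Min.min a.eval b.eval
  | abs a => |a.eval|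
  | neg a => -a.eval

/-- The number of arithmetic operations in an expression; each costs one unit of time. -/
def ops : RealExpr → ℕ
  | val _ => 0
  | add a b => a.ops + b.ops + 1
  | sub a b => a.ops + b.ops + 1
  | mul a b => a.ops + b.ops + 1
  | div a b => a.ops + b.ops + 1
  | max a b => a.ops + b.ops + 1
  | min a b => a.ops + b.ops + 1
  | abs a => a.ops + 1
  | neg a => a.ops + 1

instance : Add RealExpr := ⟨add⟩
instance : Sub RealExpr := ⟨sub⟩
instance : Mul RealExpr := ⟨mul⟩
instance : Div RealExpr := ⟨div⟩
instance : Neg RealExpr := ⟨neg⟩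

/-- The sum of the expressions `f i`, `i ∈ s`, accumulated one by one. -/
def sum {ι : Type} (s : Finset ι) (f : ι → RealExpr) : RealExpr :=
  s.toList.foldr (fun i acc => f i + acc) (val 0)

end RealExpr

/-- The probability of index `i` when sampling proportionally to the weights `w`; if all weights
vanish the index is uniform. -/
def drawProb {k : ℕ} (w : Fin k → ℝ) (i : Fin k) : ℝ :=
  if ∑ l, w l = 0 then 1 / (k : ℝ) else w i / ∑ l, w l

/-- Randomized programs returning an `α`, as computation trees: return a value, spend `c` units of
time, or draw an index of `Fin k` with probability proportional to given weights. -/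
inductive Comp (α : Type) : Type
  | ret (a : α) : Comp α
  | spend (c : ℕ) (next : Comp α) : Comp α
  | draw {k : ℕ} (w : Fin k → ℝ) (next : Fin k → Comp α) : Comp α

namespace Comp

variable {α β : Type}

/-- Sequential composition. -/
def bind : Comp α → (α → Comp β) → Comp β
  | ret a, f => f a
  | spend c p, f => spend c (p.bind f)
  | draw w next, f => draw w (fun i => (next i).bind f)

instance : Monad Comp where
  pure := ret
  bind := bind

/-- Expected value of `f` of the output. -/
def mean (f : α → ℝ) : Comp α → ℝ
  | ret a => f a
  | spend _ p => p.mean f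
  | draw w next => ∑ i, drawProb w i * (next i).mean f

/-- Worst-case running time over all random outcomes; drawing one of `k` indices costs `k`. -/
def time : Comp α → ℕ
  | ret _ => 0
  | spend c p => c + p.time
  | draw (k := k) _ next => k + Finset.univ.sup (fun i => (next i).time)

/-- Every possible output satisfies `Q`. -/
def Always (Q : α → Prop) : Comp α → Prop
  | ret a => Q a
  | spend _ p => p.Always Q
  | draw _ next => ∀ i, (next i).Always Q

/-- Draw an index proportionally to the weights `w`. -/
def sample {k : ℕ} (w : Fin k → ℝ) : Comp (Fin k) := draw w ret

/-- Evaluate one expression (its operations, and one write). -/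
def scalar (e : RealExpr) : Comp ℝ := spend (e.ops + 1) (ret e.eval)

/-- Evaluate a vector of expressions entry by entry (all their operations, one write per entry). -/
def vec {d : ℕ} (e : Fin d → RealExpr) : Comp (Fin d → ℝ) :=
  spend (∑ i, ((e i).ops + 1)) (ret fun i => (e i).eval)

/-- Run `f` repeatedly, `k` times, starting from the state `a`. -/
def iterate (f : α → Comp α) : ℕ → α → Comp α
  | 0, a => ret a
  | k + 1, a => (f a).bind (iterate f k)

end Comp

/-! ## Domains, norms, distance generating functions -/

/-- The two kinds of blocks: the probability simplex (`ℓ₁`) and the Euclidean unit ball (`ℓ₂`). -/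
inductive Block
  | simplex
  | ball

namespace Block

variable {d : ℕ}

/-- The domain of a block. -/
def dom : (b : Block) → (d : ℕ) → Set (Fin d → ℝ)
  | simplex, d => stdSimplex ℝ (Fin d)
  | ball, _ => {x | ∑ i, x i ^ 2 ≤ 1}

/-- The part of the domain where the distance generating function is differentiable: the relative
interior of the simplex, the whole closed ball. -/
def core : (b : Block) → (d : ℕ) → Set (Fin d → ℝ)
  | simplex, d => {x | x ∈ stdSimplex ℝ (Fin d) ∧ ∀ i, 0 < x i}
  | ball, _ => {x | ∑ i, x i ^ 2 ≤ 1}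

/-- The norm of a block: `ℓ₁` for the simplex, `ℓ₂` for the ball. -/
def norm : Block → (Fin d → ℝ) → ℝ
  | simplex, v => ∑ i, |v i|
  | ball, v => √(∑ i, v i ^ 2)

/-- The distance generating function `r`: negative entropy, or half the squared `ℓ₂` norm. -/
def dgf : Block → (Fin d → ℝ) → ℝ
  | simplex, x => ∑ i, x i * Real.log (x i)
  | ball, x => (∑ i, x i ^ 2) / 2

/-- The gradient of `r` (on `core`). -/
def dgfGrad : Block → (Fin d → ℝ) → Fin d → ℝ
  | simplex, x => fun i => Real.log (x i) + 1
  | ball, x => x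

/-- The Bregman divergence `V_x(x') = r(x') - r(x) - ⟨∇r(x), x' - x⟩`. -/
def breg (b : Block) (x x' : Fin d → ℝ) : ℝ :=
  b.dgf x' - b.dgf x - b.dgfGrad x ⬝ᵥ (x' - x)

/-- Unnormalized sampling weight of a coordinate of the difference `w - w₀`:
its absolute value in an `ℓ₁` block, its square in an `ℓ₂` block. -/
def weight : Block → ℝ → RealExpr
  | simplex, t => .abs (.val t)
  | ball, t => .val t * .val t

end Block

/-- The three setups; the first block is the minimizing player `x`, the second is `y`. -/
inductive Setup
  | l1l1
  | l2l1
  | l2l2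

namespace Setup

def xBlock : Setup → Block
  | l1l1 => .simplex
  | l2l1 => .ball
  | l2l2 => .ball

def yBlock : Setup → Block
  | l1l1 => .simplex
  | l2l1 => .simplex
  | l2l2 => .ball

variable {n m : ℕ}

/-- The constant `L`: `max |A i j|`, the largest `ℓ₂` norm of a row, the Frobenius norm. -/
def matConst : Setup → Matrix (Fin m) (Fin n) ℝ → ℝ
  | l1l1, A => ⨆ i, ⨆ j, |A i j|
  | l2l1, A => ⨆ i, √(∑ j, A i j ^ 2)
  | l2l2, A => √(∑ i, ∑ j, A i j ^ 2)

/-- The range parameter `Θ`. -/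
def range : Setup → ℕ → ℕ → ℝ
  | l1l1, n, m => Real.log ((m : ℝ) * n)
  | l2l1, _, m => Real.log (2 * (m : ℝ))
  | l2l2, _, _ => 1

end Setup

/-! ## The composite bilinear problem -/

/-- A point `z = (x, y)`. -/
abbrev Pt (n m : ℕ) := (Fin n → ℝ) × (Fin m → ℝ)

/-- The number of nonzero entries of `A`. -/
def nnz {n m : ℕ} (A : Matrix (Fin m) (Fin n) ℝ) : ℕ :=
  {p : Fin m × Fin n | A p.1 p.2 ≠ 0}.ncard

/-- The data of `min_x max_y yᵀ A x + φ(x) - ψ(y)`, with gradients of `φ` and `ψ`. -/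
structure Problem (n m : ℕ) where
  A : Matrix (Fin m) (Fin n) ℝ
  φ : (Fin n → ℝ) → ℝ
  gradφ : (Fin n → ℝ) → Fin n → ℝ
  ψ : (Fin m → ℝ) → ℝ
  gradψ : (Fin m → ℝ) → Fin m → ℝ

/-- Assumptions on one composite term `h` with gradient `h'` in a block `b` of dimension `d`. -/
structure IsCompositeTerm (b : Block) {d : ℕ} (h : (Fin d → ℝ) → ℝ)
    (h' : (Fin d → ℝ) → Fin d → ℝ) (μ : ℝ) : Prop where
  continuousOn : ContinuousOn h (b.dom d)
  /-- `h'` is the gradient of `h` relative to the domain: it gives the derivatives of `h` in all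
  directions that stay in the domain. -/
  isGrad : ∀ x ∈ b.core d, ∀ u ∈ b.dom d,
    HasDerivWithinAt (fun t : ℝ => h (x + t • (u - x))) (h' x ⬝ᵥ (u - x)) (Set.Ici 0) 0
  /-- `h` is `μ`-strongly convex relative to `r`. -/
  stronglyConvex : ConvexOn ℝ (b.dom d) (fun x => h x - μ * b.dgf x)
  /-- `⟨∇h(x), x - u⟩` is convex in `x` for every `u`. -/
  regretConvex : ∀ u ∈ b.dom d, ConvexOn ℝ (b.core d) (fun x => h' x ⬝ᵥ (x - u))

namespace Problem

variable {n m : ℕ} (P : Problem n m)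

/-- The objective `f(x, y) = yᵀ A x + φ(x) - ψ(y)`. -/
def obj (x : Fin n → ℝ) (y : Fin m → ℝ) : ℝ :=
  y ⬝ᵥ (P.A.mulVec x) + P.φ x - P.ψ y

/-- The duality gap. -/
def gap (S : Setup) (z : Pt n m) : ℝ :=
  sSup ((fun y => P.obj z.1 y) '' S.yBlock.dom m) -
    sInf ((fun x => P.obj x z.2) '' S.xBlock.dom n)

/-- `φ` and `ψ` grow at most linearly, with constant `B`, away from a saddle point `(x⋆, y⋆)`:
`φ(x) + ψ(y) - φ(x⋆) - ψ(y⋆) ≤ B ‖(x, y) - (x⋆, y⋆)‖`, where `‖z‖² = ‖x‖² + ‖y‖²`.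
Every `B` that bounds the dual norm of `(∇φ(x), ∇ψ(y))` over the domain has this property. -/
def LinearGrowth (S : Setup) (B : ℝ) : Prop :=
  ∀ xs ∈ S.xBlock.dom n, ∀ ys ∈ S.yBlock.dom m,
    IsSaddlePointOn (S.xBlock.dom n) (S.yBlock.dom m) P.obj xs ys →
    ∀ x ∈ S.xBlock.dom n, ∀ y ∈ S.yBlock.dom m,
      P.φ x + P.ψ y - P.φ xs - P.ψ ys ≤
        B * √(S.xBlock.norm (x - xs) ^ 2 + S.yBlock.norm (y - ys) ^ 2)

end Problem

/-! ## The algorithm -/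

/-- A minimizer of `F` on `D` (if there is one). -/
def argminOn {d : ℕ} (D : Set (Fin d → ℝ)) (F : (Fin d → ℝ) → ℝ) : Fin d → ℝ :=
  open Classical in if h : ∃ x ∈ D, IsMinOn F D x then h.choose else 0

/-- The proximal (mirror) step `argmin_w ⟨v, w⟩ + h(w) + a V_c(w) + a' V_{c'}(w)` in one block.
The composite terms are simple: a step takes time equal to the dimension. -/
def mirrorStep (b : Block) {d : ℕ} (h : (Fin d → ℝ) → ℝ) (v : Fin d → ℝ)
    (a : ℝ) (c : Fin d → ℝ) (a' : ℝ) (c' : Fin d → ℝ) : Comp (Fin d → ℝ) :=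
  .spend d (.ret (argminOn (b.dom d)
    (fun w => v ⬝ᵥ w + h w + a * b.breg c w + a' * b.breg c' w)))

/-- Evaluation of the gradient `h'` of a composite term, in time equal to the dimension. -/
def gradStep {d : ℕ} (h' : (Fin d → ℝ) → Fin d → ℝ) (x : Fin d → ℝ) : Comp (Fin d → ℝ) :=
  .spend d (.ret (h' x))

/-- Step sizes and iteration numbers: oracle quality `α`, inner step size `η`, number `T` of inner
and `K` of outer iterations. -/
structure Params where
  α : ℝ
  η : ℝ
  T : ℕ
  K : ℕ

/-- Truncation of a number to `[-τ, τ]`; no truncation for `none`. -/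
def trunc : Option ℝ → RealExpr → RealExpr
  | none, e => e
  | some τ, e => .max (.val (-τ)) (.min (.val τ) e)

namespace Problem

variable {n m : ℕ} (P : Problem n m) (S : Setup)

/-- The exact gradient mapping `g(z) = (Aᵀ y, -A x)` of the bilinear part, computed by running
through the nonzero entries of `A`. -/
def exactGrad (z : Pt n m) : Comp (Pt n m) := open Classical in do
  let gx ← Comp.vec fun j => RealExpr.sum {i | P.A i j ≠ 0} fun i => .val (P.A i j) * .val (z.2 i)
  let gy ← Comp.vec fun i =>
    -(RealExpr.sum {j | P.A i j ≠ 0} fun j => .val (P.A i j) * .val (z.1 j))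
  return (gx, gy)

/-- Sampling from the difference `w - w₀` in one block: draws an index `i` with probability `pᵢ`
proportional to the weight of `wᵢ - w₀ᵢ`, returns `i` and `(wᵢ - w₀ᵢ) / pᵢ`. -/
def sampleDiff (b : Block) {d : ℕ} (w w₀ : Fin d → ℝ) : Comp (Fin d × ℝ) := do
  let δ ← Comp.vec fun i => .val (w i) - .val (w₀ i)
  let p ← Comp.vec fun i => b.weight (δ i)
  let s ← Comp.scalar (RealExpr.sum Finset.univ fun i => .val (p i))
  let i ← Comp.sample p
  let c ← Comp.scalar (.val (δ i) / (.val (p i) / .val s))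
  return (i, c)

/-- The variance-reduced gradient estimator at `w`, centered at `w₀` with `g₀ = g(w₀)`:
`(g₀ˣ + A_{i:} [wʸ - w₀ʸ]ᵢ / pᵢ, g₀ʸ - trunc (A_{:j} [wˣ - w₀ˣ]ⱼ / qⱼ))`, with `i ∼ p`, `j ∼ q`
independent. -/
def estimator (τ : Option ℝ) (w₀ g₀ w : Pt n m) : Comp (Pt n m) := do
  let r ← sampleDiff S.yBlock w.2 w₀.2
  let c ← sampleDiff S.xBlock w.1 w₀.1
  let gx ← Comp.vec fun j => .val (g₀.1 j) + .val (P.A r.1 j) * .val r.2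
  let gy ← Comp.vec fun i => .val (g₀.2 i) - trunc τ (.val (P.A i c.1) * .val c.2)
  return (gx, gy)

/-- The truncation level: `τ = 1 / (η ρ)` in the `ℓ₂`-`ℓ₁` setup, no truncation otherwise. -/
def truncLevel (η ρ : ℝ) : Setup → Option ℝ
  | .l2l1 => some (1 / (η * ρ))
  | .l1l1 => none
  | .l2l2 => none

/-- One inner iteration; the state is the iterate `w_{t-1}` and the sum of the iterates
`w_1, …, w_{t-1}`. -/
def innerStep (q : Params) (ρ : ℝ) (w₀ g₀ : Pt n m) (s : Pt n m × Pt n m) :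
    Comp (Pt n m × Pt n m) := do
  let g ← P.estimator S (truncLevel q.η ρ S) w₀ g₀ s.1
  let ax ← Comp.scalar (.val q.α / .val 2 * .val ρ)
  let bx ← Comp.scalar (.val 1 / .val q.η * .val ρ)
  let ay ← Comp.scalar (.val q.α / .val 2 * (.val 1 / .val ρ))
  let by' ← Comp.scalar (.val 1 / .val q.η * (.val 1 / .val ρ))
  let x ← mirrorStep S.xBlock P.φ g.1 ax w₀.1 bx s.1.1
  let y ← mirrorStep S.yBlock P.ψ g.2 ay w₀.2 by' s.1.2
  let sx ← Comp.vec fun j => .val (s.2.1 j) + .val (x j)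
  let sy ← Comp.vec fun i => .val (s.2.2 i) + .val (y i)
  return ((x, y), (sx, sy))

/-- The inner loop, started at `w₀`; returns the average of `w_1, …, w_T`. -/
def innerLoop (q : Params) (ρ : ℝ) (w₀ : Pt n m) : Comp (Pt n m) := do
  let g₀ ← P.exactGrad w₀
  let s ← Comp.iterate (P.innerStep S q ρ w₀ g₀) q.T (w₀, (fun _ => 0, fun _ => 0))
  let x ← Comp.vec fun j => .val (s.2.1 j) / .val q.T
  let y ← Comp.vec fun i => .val (s.2.2 i) / .val q.T
  return (x, y)

/-- One outer iteration: the inner loop from `z_{k-1}`, giving `v = z_{k-1/2}`, followed by the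
extragradient step that is regularized around both `z_{k-1}` and `z_{k-1/2}`. -/
def outerStep (q : Params) (μ ρ : ℝ) (z : Pt n m) : Comp (Pt n m) := do
  let v ← P.innerLoop S q ρ z
  let g ← P.exactGrad v
  let hx ← gradStep P.gradφ v.1
  let hy ← gradStep P.gradψ v.2
  let gx ← Comp.vec fun j => .val (g.1 j) + .val (hx j)
  let gy ← Comp.vec fun i => .val (g.2 i) + .val (hy i)
  let ax ← Comp.scalar (.val q.α * .val ρ)
  let bx ← Comp.scalar (.val μ * .val ρ)
  let ay ← Comp.scalar (.val q.α * (.val 1 / .val ρ))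
  let by' ← Comp.scalar (.val μ * (.val 1 / .val ρ))
  let x ← mirrorStep S.xBlock (fun _ => 0) gx ax z.1 bx v.1
  let y ← mirrorStep S.yBlock (fun _ => 0) gy ay z.2 by' v.2
  return (x, y)

/-- The full rescaled algorithm, with strong monotonicity `μ = √(μˣ μʸ)` and step size ratio
`ρ = √(μˣ / μʸ)`, started at the minimizer of `r`. -/
def fullLoop (μx μy : ℝ) (q : Params) : Comp (Pt n m) := do
  let x ← Comp.spend n (.ret (argminOn (S.xBlock.dom n) S.xBlock.dgf))
  let y ← Comp.spend m (.ret (argminOn (S.yBlock.dom m) S.yBlock.dgf))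
  Comp.iterate (P.outerStep S q √(μx * μy) √(μx / μy)) q.K (x, y)

end Problem

/-! ## The running time bound -/

/-- The factor `log ((B + L) √Θ̂ / ε)`, `Θ̂ = (√(μˣ/μʸ) + √(μʸ/μˣ))² Θ`, read as `1` when it is
smaller than `1`. -/
def logFactor (L B Θ μx μy ε : ℝ) : ℝ :=
  max 1 (Real.log ((B + L) * √((√(μx / μy) + √(μy / μx)) ^ 2 * Θ) / ε))

/-- The quantity `√(N (m + n)) L / √(μˣ μʸ)`. -/
def condTerm (n m N : ℕ) (L μx μy : ℝ) : ℝ :=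
  √((N : ℝ) * (m + n)) * (L / √(μx * μy))

end SaddleVR

end

open SaddleVR

namespace SaddleVR

open Finset

/-! ### Geometry of the two blocks: entropy and Euclidean divergences. -/

namespace Block

variable {d : ℕ}

/-! Linear growth away from a saddle point bounds the gap by a multiple of the distance to it,
hence, after Young's inequality, by a multiple of the rescaled divergence `div` plus `ε / 2`
(`gap_le_div`). So it suffices that an outer iteration shrinks the expected divergence to a fixed
saddle point by the factor `α / (α + μ)`. By the three-point inequality of the extragradient step
and relative strong convexity (`div_outerPoint_le`), this holds once the averaged inner iterate `v`
is a relaxed proximal point: the mean of `regret v u - α * div z u` is at most `0`, even when the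
comparator `u` depends on the random outcome. That freedom is essential, because `u` will be the
next outer iterate, which depends on `v`.

The inner loop (`mean_inner_le`) is stochastic mirror descent started at `w₀ = z`, and rests on four
points. Importance sampling from `w - w₀` gives second moments proportional to `L ^ 2 * ‖w - w₀‖ ^
2`, so the noise is paid for by the regularizer `α / 2 * V_{w₀}`. In the ℓ₂-ℓ₁ setup only entrywise
moments are bounded; there a local norm bound for clipped estimators replaces the dual norm bound,
and the clipping bias has the same order as the variance. The bilinear gradient is estimated at the
previous iterate while the regret is measured at the new one. Since the bilinear operator is
skew-symmetric, the discrepancy telescopes to one boundary term (`pair_sub_le`). A ghost mirror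
descent driven by the noise absorbs its correlation with the random comparator
(`stochastic_mirror_step`). Convexity of `⟨∇φ(x), x - u⟩` and `⟨∇ψ(y), y - v⟩` passes the bound from
the iterates to their average (`regret_avg_succ`).

The requirements are that `η` is of order `α / L ^ 2` and `T` of order `L ^ 2 / α ^ 2`. Taking `α =
L * √((m + n) / N)` makes the `T` inner steps, of cost `m + n` each, as expensive as one exact
gradient, up to constants; then `μ / α = N / X`, which gives the logarithm in the time bound. -/

theorem core_subset_dom (b : Block) : b.core d ⊆ b.dom d := by
  cases b
  · exact fun x hx => hx.1
  · exact fun x hx => hx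

theorem breg_three_point (b : Block) (c w u : Fin d → ℝ) :
    (b.dgfGrad w - b.dgfGrad c) ⬝ᵥ (u - w) = b.breg c u - b.breg w u - b.breg c w := by
  simp only [breg, sub_dotProduct, dotProduct_sub]
  ring

theorem breg_self (b : Block) (w : Fin d → ℝ) : b.breg w w = 0 := by
  simp [breg]

theorem breg_ball (x y : Fin d → ℝ) : ball.breg x y = (∑ i, (y i - x i) ^ 2) / 2 := by
  simp only [breg, dgf, dgfGrad, dotProduct, Pi.sub_apply, sum_div]
  rw [← sum_sub_distrib, ← sum_sub_distrib]
  exact sum_congr rfl fun i _ => by ring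

/-- The terms `- y i + x i` cancel in the sum over the simplex but make every single summand
nonnegative, so that later estimates can be done coordinate by coordinate. -/
theorem breg_simplex {x y : Fin d → ℝ} (hx : x ∈ stdSimplex ℝ (Fin d))
    (hy : y ∈ stdSimplex ℝ (Fin d)) :
    simplex.breg x y = ∑ i, (y i * Real.log (y i) - y i * Real.log (x i) - y i + x i) := by
  have h1 := hx.2
  have h2 := hy.2
  simp only [breg, dgf, dgfGrad, dotProduct, Pi.sub_apply]
  rw [← sum_sub_distrib, ← sum_sub_distrib]
  exact sum_congr rfl fun i _ => by ring

/-- The scalar Fenchel inequality for the entropy. -/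
theorem mul_log_sub_ge {y s : ℝ} (hy : 0 ≤ y) (hs : 0 < s) :
    0 ≤ y * Real.log y - y * Real.log s - y + s := by
  rcases hy.eq_or_lt with rfl | hy
  · simpa using hs.le
  · have h := Real.one_sub_inv_le_log_of_pos (div_pos hy hs)
    rw [Real.log_div hy.ne' hs.ne', inv_div] at h
    have h2 := mul_le_mul_of_nonneg_left h hy.le
    have : y * (1 - s / y) = y - s := by field_simp
    nlinarith

/-- Squared Hellinger distance is below relative entropy, termwise: apply `log s ≥ 1 - 1 / s` to `s
= √y / √x`. -/
theorem sq_sqrt_sub_le {x y : ℝ} (hx : 0 < x) (hy : 0 ≤ y) :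
    (√y - √x) ^ 2 ≤ y * Real.log y - y * Real.log x - y + x := by
  rcases hy.eq_or_lt with rfl | hy
  · simp [Real.sq_sqrt hx.le]
  · have hsx := Real.sqrt_pos.2 hx
    have hsy := Real.sqrt_pos.2 hy
    have ex := Real.sq_sqrt hx.le
    have ey := Real.sq_sqrt hy.le
    have h := Real.one_sub_inv_le_log_of_pos (div_pos hsy hsx)
    rw [Real.log_div hsy.ne' hsx.ne', inv_div, Real.log_sqrt hx.le, Real.log_sqrt hy.le] at h
    have h2 := mul_le_mul_of_nonneg_left h hy.le
    have : y * (1 - √x / √y) = y - √x * √y := by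
      nth_rw 1 [← ey]
      field_simp
      nlinarith
    nlinarith

theorem norm_nonneg (b : Block) (v : Fin d → ℝ) : 0 ≤ b.norm v := by
  cases b
  · exact sum_nonneg fun i _ => abs_nonneg _
  · exact Real.sqrt_nonneg _

theorem norm_neg (b : Block) (v : Fin d → ℝ) : b.norm (-v) = b.norm v := by
  cases b <;> simp [norm]

theorem norm_sub_comm (b : Block) (v w : Fin d → ℝ) : b.norm (v - w) = b.norm (w - v) := by
  rw [← neg_sub, norm_neg]

theorem norm_le_one (b : Block) {v : Fin d → ℝ} (hv : v ∈ b.dom d) : b.norm v ≤ 1 := by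
  cases b
  · have : ∑ i, |v i| = ∑ i, v i := sum_congr rfl fun i _ => abs_of_nonneg (hv.1 i)
    exact (this.trans hv.2).le
  · exact Real.sqrt_le_one.2 hv

/-- Strong convexity of the distance generating function. -/
theorem norm_sq_le_breg (b : Block) {x y : Fin d → ℝ} (hx : x ∈ b.core d) (hy : y ∈ b.dom d) :
    b.norm (y - x) ^ 2 ≤ 4 * b.breg x y := by
  cases b
  · have hx' := hx.1
    rw [breg_simplex hx' hy]
    -- Cauchy–Schwarz on `|y - x| = |√y - √x| * (√y + √x)`. The second factor is at most `4`, which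
    -- is the constant of the lemma; the sharper constant of Pinsker's inequality is not needed.
    have h1 : (∑ i, |y i - x i|) ^ 2 ≤
        (∑ i, (√(y i) - √(x i)) ^ 2) * ∑ i, (√(y i) + √(x i)) ^ 2 := by
      refine le_trans (le_of_eq ?_) ((sum_mul_sq_le_sq_mul_sq univ
        (fun i => |√(y i) - √(x i)|) (fun i => √(y i) + √(x i))).trans_eq ?_)
      · congr 1
        refine sum_congr rfl fun i _ => ?_
        have e1 := Real.sq_sqrt (hy.1 i)
        have e2 := Real.sq_sqrt (hx'.1 i)
        rw [← abs_of_nonneg (add_nonneg (Real.sqrt_nonneg (y i)) (Real.sqrt_nonneg (x i))),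
          ← abs_mul]
        congr 1
        nlinarith
      · simp only [sq_abs]
    have h2 : ∑ i, (√(y i) - √(x i)) ^ 2 ≤
        ∑ i, (y i * Real.log (y i) - y i * Real.log (x i) - y i + x i) :=
      sum_le_sum fun i _ => sq_sqrt_sub_le (hx.2 i) (hy.1 i)
    have h3 : ∑ i, (√(y i) + √(x i)) ^ 2 ≤ 4 := by
      have : ∑ i, (√(y i) + √(x i)) ^ 2 ≤ ∑ i, (2 * y i + 2 * x i) := sum_le_sum fun i _ => by
        have e1 := Real.sq_sqrt (hy.1 i)
        have e2 := Real.sq_sqrt (hx'.1 i)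
        nlinarith [sq_nonneg (√(y i) - √(x i))]
      rw [sum_add_distrib, ← mul_sum, ← mul_sum, hy.2, hx'.2] at this
      linarith
    have h4 : 0 ≤ ∑ i, (√(y i) - √(x i)) ^ 2 := sum_nonneg fun i _ => sq_nonneg _
    simp only [norm, Pi.sub_apply]
    nlinarith
  · rw [breg_ball]
    simp only [norm, Pi.sub_apply]
    have h4 : 0 ≤ ∑ i, (y i - x i) ^ 2 := sum_nonneg fun i _ => sq_nonneg _
    rw [Real.sq_sqrt h4]
    linarith

theorem breg_nonneg (b : Block) {x y : Fin d → ℝ} (hx : x ∈ b.core d) (hy : y ∈ b.dom d) :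
    0 ≤ b.breg x y := by
  nlinarith [norm_sq_le_breg b hx hy, sq_nonneg (b.norm (y - x))]

/-- The local norm bound for a mirror step with bounded steps in the simplex. -/
theorem dotProduct_sub_breg_le_local {e : ℝ} (he : 0 < e) {γ w w' : Fin d → ℝ}
    (hγ : ∀ i, e * |γ i| ≤ 1) (hw : w ∈ simplex.core d) (hw' : w' ∈ simplex.dom d) :
    γ ⬝ᵥ (w - w') - 1 / e * simplex.breg w w' ≤ e * ∑ i, w i * γ i ^ 2 := by
  rw [breg_simplex hw.1 hw']
  have key : ∑ i, e * (γ i * (w i - w' i)) -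
      ∑ i, (w' i * Real.log (w' i) - w' i * Real.log (w i) - w' i + w i) ≤
      ∑ i, e ^ 2 * (w i * γ i ^ 2) - ∑ i, w' i + ∑ i, w i - ∑ i, w i + ∑ i, w' i := by
    rw [← sum_sub_distrib, ← sum_sub_distrib, ← sum_add_distrib, ← sum_sub_distrib,
      ← sum_add_distrib]
    refine sum_le_sum fun i _ => ?_
    -- The point `w i * exp (-(e * γ i))` is the unconstrained multiplicative update, where
    -- Fenchel's inequality is tight. The bounded step `e * |γ i| ≤ 1` then allows `exp t ≤ 1 + t +
    -- t ^ 2`.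
    have h1 := mul_log_sub_ge (hw'.1 i) (mul_pos (hw.2 i) (Real.exp_pos (-(e * γ i))))
    rw [Real.log_mul (hw.2 i).ne' (Real.exp_pos _).ne', Real.log_exp] at h1
    have h2 := (abs_le.1 (Real.abs_exp_sub_one_sub_id_le (x := -(e * γ i))
      (by rw [abs_neg, abs_mul, abs_of_pos he]; exact hγ i))).2
    have h3 := mul_le_mul_of_nonneg_left h2 (hw.2 i).le
    nlinarith
  have e1 : ∑ i, e * (γ i * (w i - w' i)) = e * (γ ⬝ᵥ (w - w')) := by
    simp [dotProduct, mul_sum]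
  have e2 : ∑ i, e ^ 2 * (w i * γ i ^ 2) = e * (e * ∑ i, w i * γ i ^ 2) := by
    rw [← mul_sum]; ring
  rw [e1, e2] at key
  set V := ∑ i, (w' i * Real.log (w' i) - w' i * Real.log (w i) - w' i + w i)
  have : e * (γ ⬝ᵥ (w - w') - 1 / e * V) = e * (γ ⬝ᵥ (w - w')) - V := by field_simp
  exact le_of_mul_le_mul_left (by rw [this]; linarith) he

/-- The dual norm bound for a mirror step. -/
theorem dotProduct_sub_breg_le (b : Block) {e κ : ℝ} (he : 0 < e) {γ w w' : Fin d → ℝ}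
    (hγ : ∀ v : Fin d → ℝ, |γ ⬝ᵥ v| ≤ κ * b.norm v) (hw : w ∈ b.core d) (hw' : w' ∈ b.dom d) :
    γ ⬝ᵥ (w - w') - 1 / e * b.breg w w' ≤ e * κ ^ 2 := by
  have h1 := norm_sq_le_breg b hw hw'
  have h2 := (le_abs_self _).trans (hγ (w - w'))
  rw [norm_sub_comm] at h2
  set N := b.norm (w' - w)
  have h3 : κ * N ≤ e * κ ^ 2 + 1 / e * (N ^ 2 / 4) := by
    have : e * κ ^ 2 + 1 / e * (N ^ 2 / 4) - κ * N = e * (κ - N / (2 * e)) ^ 2 := by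
      field_simp
      ring
    have h4 : 0 ≤ e * (κ - N / (2 * e)) ^ 2 := by positivity
    linarith
  have h5 : 1 / e * (N ^ 2 / 4) ≤ 1 / e * b.breg w w' := by gcongr; linarith
  linarith

theorem convex_dom (b : Block) : Convex ℝ (b.dom d) := by
  cases b
  · exact convex_stdSimplex ℝ _
  · intro x hx y hy s t hs ht hst
    change ∑ i, x i ^ 2 ≤ 1 at hx
    change ∑ i, y i ^ 2 ≤ 1 at hy
    change ∑ i, (s * x i + t * y i) ^ 2 ≤ 1
    have : ∑ i, (s * x i + t * y i) ^ 2 ≤ ∑ i, (s * x i ^ 2 + t * y i ^ 2) :=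
      sum_le_sum fun i _ => by
        have : t = 1 - s := by linarith
        subst this
        nlinarith [mul_nonneg (mul_nonneg hs ht) (sq_nonneg (x i - y i))]
    rw [sum_add_distrib, ← mul_sum, ← mul_sum] at this
    nlinarith

theorem convex_core (b : Block) : Convex ℝ (b.core d) := by
  cases b
  · intro x hx y hy s t hs ht hst
    refine ⟨convex_stdSimplex ℝ _ hx.1 hy.1 hs ht hst, fun i => ?_⟩
    simp only [Pi.add_apply, Pi.smul_apply, smul_eq_mul]
    rcases hs.eq_or_lt with rfl | hs
    · obtain rfl : t = 1 := by linarith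
      simpa using hy.2 i
    · have h1 := mul_pos hs (hx.2 i)
      have h2 := mul_nonneg ht (hy.2 i).le
      linarith
  · exact convex_dom ball

theorem isCompact_dom (b : Block) : IsCompact (b.dom d) := by
  cases b
  · exact isCompact_stdSimplex ℝ _
  · refine Metric.isCompact_of_isClosed_isBounded ?_ ?_
    · exact isClosed_le (by fun_prop) continuous_const
    · refine (Metric.isBounded_closedBall (x := (0 : Fin d → ℝ)) (r := 1)).subset fun x hx => ?_
      rw [mem_closedBall_zero_iff, pi_norm_le_iff_of_nonneg zero_le_one]
      intro i
      have h1 : x i ^ 2 ≤ ∑ i, x i ^ 2 :=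
        single_le_sum (f := fun i => x i ^ 2) (fun i _ => sq_nonneg _) (mem_univ i)
      exact abs_le_one_iff_mul_self_le_one.2 (by have := h1.trans hx; nlinarith)

theorem core_nonempty (b : Block) (hd : 0 < d) : (b.core d).Nonempty := by
  have hd' : (0 : ℝ) < d := by exact_mod_cast hd
  cases b
  · refine ⟨fun _ => 1 / d, ⟨fun i => by positivity, ?_⟩, fun i => by positivity⟩
    simp [hd'.ne']
  · exact ⟨0, by simp [core]⟩

theorem continuous_dgf (b : Block) : Continuous (b.dgf : (Fin d → ℝ) → ℝ) := by
  cases b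
  · exact continuous_finsetSum _ fun i _ =>
      Real.continuous_mul_log.comp (continuous_apply i)
  · change Continuous fun x : Fin d → ℝ => (∑ i, x i ^ 2) / 2
    fun_prop

theorem convexOn_dgf (b : Block) : ConvexOn ℝ (b.dom d) (b.dgf : (Fin d → ℝ) → ℝ) := by
  refine ⟨convex_dom b, ?_⟩
  cases b
  · intro x hx y hy s t hs ht hst
    simp only [dgf, smul_eq_mul, mul_sum]
    rw [← sum_add_distrib]
    refine sum_le_sum fun i _ => ?_
    exact Real.convexOn_mul_log.2 (hx.1 i) (hy.1 i) hs ht hst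
  · intro x hx y hy s t hs ht hst
    simp only [dgf, smul_eq_mul, sum_div, mul_sum]
    rw [← sum_add_distrib]
    refine sum_le_sum fun i _ => ?_
    obtain rfl : t = 1 - s := by linarith
    simp only [Pi.add_apply, Pi.smul_apply, smul_eq_mul]
    nlinarith [mul_nonneg (mul_nonneg hs ht) (sq_nonneg (x i - y i))]

theorem hasDerivWithinAt_dgf (b : Block) {x : Fin d → ℝ} (hx : x ∈ b.core d) (u : Fin d → ℝ) :
    HasDerivWithinAt (fun t : ℝ => b.dgf (x + t • (u - x))) (b.dgfGrad x ⬝ᵥ (u - x))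
      (Set.Ici 0) 0 := by
  have hl : ∀ i, HasDerivAt (fun t : ℝ => x i + t * (u i - x i)) (u i - x i) 0 := fun i => by
    simpa using ((hasDerivAt_id (0 : ℝ)).mul_const (u i - x i)).const_add (x i)
  refine HasDerivAt.hasDerivWithinAt ?_
  cases b
  · simp only [dgf, dgfGrad, dotProduct, Pi.add_apply, Pi.smul_apply, Pi.sub_apply, smul_eq_mul]
    refine HasDerivAt.fun_sum fun i _ => ?_
    have h := Real.hasDerivAt_mul_log (x := x i + 0 * (u i - x i)) (by simpa using (hx.2 i).ne')
    simpa [Function.comp_def] using h.comp 0 (hl i)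
  · simp only [dgf, dgfGrad, dotProduct, Pi.add_apply, Pi.smul_apply, Pi.sub_apply, smul_eq_mul,
      sum_div]
    refine HasDerivAt.fun_sum fun i _ => ?_
    convert! ((hl i).pow 2).div_const 2 using 1
    simp
    ring

end Block

/-! ### Proximal steps: interiority, optimality conditions, range of `r`. -/

/-- A convex differentiable term of a proximal step in a block. -/
structure IsConvexTerm (b : Block) {d : ℕ} (h : (Fin d → ℝ) → ℝ)
    (h' : (Fin d → ℝ) → Fin d → ℝ) : Prop where
  continuousOn : ContinuousOn h (b.dom d)
  isGrad : ∀ x ∈ b.core d, ∀ u ∈ b.dom d,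
    HasDerivWithinAt (fun t : ℝ => h (x + t • (u - x))) (h' x ⬝ᵥ (u - x)) (Set.Ici 0) 0
  convexOn : ConvexOn ℝ (b.dom d) h

section

variable {b : Block} {d : ℕ} {h : (Fin d → ℝ) → ℝ} {h' : (Fin d → ℝ) → Fin d → ℝ}

/-- The zero term covers the extragradient step and the ghost steps, which have no composite part.
-/
theorem isConvexTerm_zero :
    IsConvexTerm b (d := d) (fun _ => 0) (fun _ => 0) where
  continuousOn := continuousOn_const
  isGrad x _ u _ := by simpa using hasDerivWithinAt_const (0 : ℝ) (Set.Ici 0) (0 : ℝ)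
  convexOn := convexOn_const 0 b.convex_dom

theorem IsCompositeTerm.isConvexTerm {μ : ℝ} (H : IsCompositeTerm b h h' μ) (hμ : 0 ≤ μ) :
    IsConvexTerm b h h' where
  continuousOn := H.continuousOn
  isGrad := H.isGrad
  convexOn := by
    have := H.stronglyConvex.add (b.convexOn_dgf.smul hμ)
    exact this.congr fun x _ => by simp

/-- One-sided derivatives at the left end of a function that is minimal there are nonnegative. -/
theorem nonneg_of_hasDerivWithinAt_of_le {g : ℝ → ℝ} {D : ℝ}
    (hg : HasDerivWithinAt g D (Set.Ici 0) 0) (hmin : ∀ t ∈ Set.Ioc (0 : ℝ) 1, g 0 ≤ g t) :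
    0 ≤ D := by
  rw [← hasDerivWithinAt_Ioi_iff_Ici, hasDerivWithinAt_iff_tendsto_slope' (by simp)] at hg
  refine ge_of_tendsto hg ?_
  filter_upwards [Ioc_mem_nhdsGT (zero_lt_one' ℝ)] with t ht
  rw [slope_def_field]
  exact div_nonneg (by linarith [hmin t ht]) (by linarith [ht.1])

theorem mem_dom_segment {x u : Fin d → ℝ} (hx : x ∈ b.dom d) (hu : u ∈ b.dom d) {t : ℝ}
    (ht : t ∈ Set.Icc (0 : ℝ) 1) : x + t • (u - x) ∈ b.dom d :=
  b.convex_dom.add_smul_sub_mem hx hu ht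

theorem segment_eq (x u : Fin d → ℝ) (t : ℝ) : x + t • (u - x) = (1 - t) • x + t • u := by
  module

/-- Gradient inequality: convexity gives a lower bound by the linearization. -/
theorem le_sub_of_convexOn {x u : Fin d → ℝ} {D : ℝ} (hh : ConvexOn ℝ (b.dom d) h)
    (hx : x ∈ b.dom d) (hu : u ∈ b.dom d)
    (hD : HasDerivWithinAt (fun t : ℝ => h (x + t • (u - x))) D (Set.Ici 0) 0) :
    D ≤ h u - h x := by
  have h1 : HasDerivWithinAt (fun t : ℝ => t * (h u - h x) - h (x + t • (u - x)))
      (1 * (h u - h x) - D) (Set.Ici 0) 0 :=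
    ((hasDerivWithinAt_id (0 : ℝ) (Set.Ici 0)).mul_const (h u - h x)).sub hD
  have h2 := nonneg_of_hasDerivWithinAt_of_le h1 fun t ht => by
    have := hh.2 hx hu (sub_nonneg.2 ht.2) ht.1.le (by ring)
    rw [← segment_eq] at this
    simp only [smul_eq_mul] at this
    simp only [zero_mul, zero_smul, add_zero]
    linarith
  linarith

/-- A minimizer of a convex function plus a positive multiple of `r` lies in the core. -/
theorem mem_core_of_isMinOn {A : ℝ} (hA : 0 < A) (hh : ConvexOn ℝ (b.dom d) h) {w : Fin d → ℝ}
    (hw : w ∈ b.dom d) (hmin : IsMinOn (fun x => h x + A * b.dgf x) (b.dom d) w) :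
    w ∈ b.core d := by
  cases b
  swap
  · exact hw
  refine ⟨hw, ?_⟩
  by_contra! hcon
  obtain ⟨i, hi⟩ := hcon
  have hwi : w i = 0 := le_antisymm hi (hw.1 i)
  obtain ⟨c, hc⟩ := Block.core_nonempty .simplex (Fin.pos i)
  set F := fun x => h x + A * Block.simplex.dgf x with hF
  have hAc : 0 < A * c i := mul_pos hA (hc.2 i)
  -- The slope of the entropy at a vanishing coordinate is `-∞`: moving from `w` by `t` towards the
  -- interior point `c` changes the objective by at most `t * (F c - F w)` plus `A * c i * t * log
  -- t`, and minimality forbids a decrease.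
  have key : ∀ t ∈ Set.Ioc (0 : ℝ) 1, 0 ≤ F c - F w + A * c i * Real.log t := by
    intro t ht
    have h0 := isMinOn_iff.1 hmin _ (mem_dom_segment hw hc.1 ⟨ht.1.le, ht.2⟩)
    rw [segment_eq] at h0
    have h1 := hh.2 hw hc.1 (sub_nonneg.2 ht.2) ht.1.le (by ring)
    have h2 : Block.simplex.dgf ((1 - t) • w + t • c) ≤
        (1 - t) * Block.simplex.dgf w + t * Block.simplex.dgf c + t * c i * Real.log t := by
      simp only [Block.dgf, mul_sum]
      have e : t * c i * Real.log t = ∑ j, if j = i then t * c i * Real.log t else 0 := by simp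
      rw [e, ← sum_add_distrib, ← sum_add_distrib]
      refine sum_le_sum fun j _ => ?_
      split_ifs with hj
      · subst hj
        simp only [Pi.add_apply, Pi.smul_apply, smul_eq_mul, hwi, mul_zero, zero_add, zero_mul]
        rw [Real.log_mul ht.1.ne' (hc.2 j).ne']
        exact le_of_eq (by ring)
      · rw [add_zero]
        exact Real.convexOn_mul_log.2 (hw.1 j) (hc.1.1 j) (sub_nonneg.2 ht.2) ht.1.le (by ring)
    simp only [smul_eq_mul] at h1
    have h3 := mul_le_mul_of_nonneg_left h2 hA.le
    simp only [hF] at h0 ⊢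
    refine nonneg_of_mul_nonneg_right (a := t) ?_ ht.1
    linarith
  set G := F c - F w
  -- This `t` makes the logarithmic term equal to `-(|G| + 1)`, contradicting `key`.
  have h1 := key (Real.exp (-((|G| + 1) / (A * c i)))) ⟨Real.exp_pos _, Real.exp_le_one_iff.2
    (by rw [neg_nonpos]; positivity)⟩
  rw [Real.log_exp, mul_neg, mul_div_cancel₀ _ hAc.ne'] at h1
  linarith [le_abs_self G]

theorem argminOn_spec {D : Set (Fin d → ℝ)} {F : (Fin d → ℝ) → ℝ} (hD : IsCompact D)
    (hne : D.Nonempty) (hF : ContinuousOn F D) : argminOn D F ∈ D ∧ IsMinOn F D (argminOn D F) := by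
  have h := hD.exists_isMinOn hne hF
  rw [argminOn, dif_pos h]
  exact h.choose_spec

theorem dotProduct_convexOn (v : Fin d → ℝ) {s : Set (Fin d → ℝ)} (hs : Convex ℝ s) :
    ConvexOn ℝ s (fun x => v ⬝ᵥ x) := by
  refine ⟨hs, fun x _ y _ p q _ _ _ => le_of_eq ?_⟩
  simp [dotProduct_add, dotProduct_smul]

theorem continuous_dotProduct_left (v : Fin d → ℝ) : Continuous (fun x => v ⬝ᵥ x) := by
  unfold dotProduct
  fun_prop

theorem Block.continuous_breg (b : Block) (c : Fin d → ℝ) : Continuous (b.breg c) := by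
  unfold Block.breg
  exact ((b.continuous_dgf.sub continuous_const).sub
    ((continuous_dotProduct_left _).comp (continuous_id.sub continuous_const)))

/-- The optimality condition of a proximal step, in three-point form. -/
theorem mirror_three_point (H : IsConvexTerm b h h') (hd : 0 < d) (v : Fin d → ℝ) {a a' : ℝ}
    (ha : 0 < a + a') (c c' w : Fin d → ℝ)
    (hw : w = argminOn (b.dom d) (fun w => v ⬝ᵥ w + h w + a * b.breg c w + a' * b.breg c' w)) :
    w ∈ b.core d ∧ ∀ u ∈ b.dom d,
      (v + h' w) ⬝ᵥ (w - u) ≤ a * (b.breg c u - b.breg w u - b.breg c w) +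
        a' * (b.breg c' u - b.breg w u - b.breg c' w) := by
  have hcont : ContinuousOn (fun w => v ⬝ᵥ w + h w + a * b.breg c w + a' * b.breg c' w)
      (b.dom d) :=
    (((continuous_dotProduct_left v).continuousOn.add H.continuousOn).add
      (continuous_const.mul (b.continuous_breg c)).continuousOn).add
      (continuous_const.mul (b.continuous_breg c')).continuousOn
  obtain ⟨hwd, hmin⟩ := argminOn_spec b.isCompact_dom
    ((b.core_nonempty hd).mono b.core_subset_dom) hcont
  rw [← hw] at hwd hmin
  -- Up to constants both divergences are `r` plus linear terms; collecting the latter in `v'`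
  -- leaves a convex function plus `(a + a') * r`.
  set v' := v - a • b.dgfGrad c - a' • b.dgfGrad c' with hv'
  have hmin' : IsMinOn (fun x => (v' ⬝ᵥ x + h x) + (a + a') * b.dgf x) (b.dom d) w := by
    rw [isMinOn_iff] at hmin ⊢
    intro x hx
    have := hmin x hx
    simp only [Block.breg, dotProduct_sub] at this
    simp only [hv', sub_dotProduct, smul_dotProduct, smul_eq_mul]
    linarith
  have hcore : w ∈ b.core d :=
    mem_core_of_isMinOn ha ((dotProduct_convexOn v' b.convex_dom).add H.convexOn) hwd hmin'
  refine ⟨hcore, fun u hu => ?_⟩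
  have hlin : HasDerivWithinAt (fun t : ℝ => v' ⬝ᵥ (w + t • (u - w))) (v' ⬝ᵥ (u - w))
      (Set.Ici 0) 0 := by
    simp only [dotProduct_add, dotProduct_smul, smul_eq_mul]
    simpa using (((hasDerivAt_id (0 : ℝ)).mul_const (v' ⬝ᵥ (u - w))).const_add
      (v' ⬝ᵥ w)).hasDerivWithinAt
  have hder := (hlin.add (H.isGrad w hcore u hu)).add
    ((b.hasDerivWithinAt_dgf hcore u).const_mul (a + a'))
  have hnn := nonneg_of_hasDerivWithinAt_of_le hder fun t ht => by
    have := isMinOn_iff.1 hmin' _ (mem_dom_segment hwd hu ⟨ht.1.le, ht.2⟩)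
    simpa using this
  rw [← Block.breg_three_point, ← Block.breg_three_point]
  have e : w - u = -(u - w) := by abel
  rw [e, dotProduct_neg]
  simp only [hv', sub_dotProduct, smul_dotProduct, smul_eq_mul, add_dotProduct] at hnn ⊢
  linarith

/-- The range of `r`. -/
noncomputable def Block.rangeConst : Block → ℕ → ℝ
  | .simplex, d => Real.log d
  | .ball, _ => 1 / 2

/-- On the simplex the negative entropy is at most `0`, and at least `-log d` by comparison with the
uniform distribution. -/
theorem Block.dgf_sub_le (b : Block) {u z : Fin d → ℝ} (hu : u ∈ b.dom d) (hz : z ∈ b.dom d) :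
    b.dgf u - b.dgf z ≤ b.rangeConst d := by
  cases b
  · have h1 : ∑ i, u i * Real.log (u i) ≤ 0 := sum_nonpos fun i _ =>
      mul_nonpos_of_nonneg_of_nonpos (hu.1 i) (Real.log_nonpos (hu.1 i)
        ((single_le_sum (f := u) (fun j _ => hu.1 j) (mem_univ i)).trans hu.2.le))
    have hd : 0 < d := by
      rcases Nat.eq_zero_or_pos d with rfl | hd
      · simpa using hu.2
      · exact hd
    have hd' : (0 : ℝ) < d := by exact_mod_cast hd
    have h2 : 0 ≤ ∑ i, (z i * Real.log (z i) - z i * Real.log (1 / d) - z i + 1 / d) :=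
      sum_nonneg fun i _ => Block.mul_log_sub_ge (hz.1 i) (by positivity)
    rw [sum_add_distrib, sum_sub_distrib, sum_sub_distrib, ← sum_mul, hz.2] at h2
    simp [hd'.ne'] at h2
    simp only [Block.dgf, Block.rangeConst]
    linarith
  · have h1 : ∑ i, u i ^ 2 ≤ 1 := hu
    have h2 : 0 ≤ ∑ i, z i ^ 2 := sum_nonneg fun i _ => sq_nonneg _
    simp only [Block.dgf, Block.rangeConst]
    linarith

/-- The minimizer of `r` is a point of the core with small divergence to every other point. -/
theorem argminOn_dgf_spec (b : Block) (hd : 0 < d) :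
    argminOn (b.dom d) b.dgf ∈ b.core d ∧
      ∀ u ∈ b.dom d, b.breg (argminOn (b.dom d) b.dgf) u ≤ b.rangeConst d := by
  obtain ⟨hz, hmin⟩ := argminOn_spec b.isCompact_dom
    ((b.core_nonempty hd).mono b.core_subset_dom) (b.continuous_dgf (d := d)).continuousOn
  set z := argminOn (b.dom d) b.dgf
  have hcore : z ∈ b.core d := mem_core_of_isMinOn (A := 1) one_pos (convexOn_const 0 b.convex_dom)
    hz (by simpa using hmin)
  refine ⟨hcore, fun u hu => ?_⟩
  have hnn := nonneg_of_hasDerivWithinAt_of_le (b.hasDerivWithinAt_dgf hcore u) fun t ht => by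
    have := isMinOn_iff.1 hmin _ (mem_dom_segment hz hu ⟨ht.1.le, ht.2⟩)
    simpa using this
  have := b.dgf_sub_le hu hz
  rw [Block.breg]
  linarith

end

/-! ## Gradient estimators in one block -/

/-- Quality of a randomized gradient estimator `γ` of `δ`, drawn with probabilities `p`, for mirror
steps of size `e` in the block `b`. -/
structure IsGoodEstimator (b : Block) {d k : ℕ} (e : ℝ) (p : Fin k → ℝ) (γ : Fin k → Fin d → ℝ)
    (δ : Fin d → ℝ) (v : ℝ) : Prop where
  step : ∀ w ∈ b.core d, ∀ w' : Fin k → Fin d → ℝ, (∀ i, w' i ∈ b.core d) →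
    ∑ i, p i * (γ i ⬝ᵥ (w - w' i) - 1 / e * b.breg w (w' i)) ≤ e * v
  ghost : ∀ s ∈ b.core d, ∀ s' : Fin k → Fin d → ℝ, (∀ i, s' i ∈ b.core d) →
    ∑ i, p i * ((∑ l, p l • γ l - γ i) ⬝ᵥ (s - s' i) - 2 / e * b.breg s (s' i)) ≤ e * v
  bias : ∀ w ∈ b.core d, ∀ u ∈ b.dom d, (δ - ∑ l, p l • γ l) ⬝ᵥ (w - u) ≤ e * v

section

variable {b : Block} {d k : ℕ} {e : ℝ} {p : Fin k → ℝ} {γ : Fin k → Fin d → ℝ} {δ : Fin d → ℝ}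

theorem sq_mean_le (hp : ∀ i, 0 ≤ p i) (hp1 : ∑ i, p i = 1) (f : Fin k → ℝ) :
    (∑ i, p i * f i) ^ 2 ≤ ∑ i, p i * f i ^ 2 := by
  set m := ∑ i, p i * f i with hm
  have h : 0 ≤ ∑ i, p i * (f i - m) ^ 2 := sum_nonneg fun i _ => mul_nonneg (hp i) (sq_nonneg _)
  have e : ∀ a : ℝ, ∑ i, p i * (f i - a) ^ 2 = ∑ i, p i * f i ^ 2 - 2 * a * ∑ i, p i * f i +
      a ^ 2 * ∑ i, p i := fun a => by
    rw [mul_sum, mul_sum, ← sum_sub_distrib, ← sum_add_distrib]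
    exact sum_congr rfl fun i _ => by ring
  rw [e, hp1, ← hm] at h
  linarith

/-- Unbiased estimators with bounded second moment of the dual norm. -/
theorem isGoodEstimator_of_unbiased (he : 0 < e) (hp : ∀ i, 0 ≤ p i) (hp1 : ∑ i, p i = 1)
    {κ : Fin k → ℝ} (hγ : ∀ i, ∀ v : Fin d → ℝ, |γ i ⬝ᵥ v| ≤ κ i * b.norm v) {M : ℝ}
    (hM : ∑ i, p i * κ i ^ 2 ≤ M) (hδ : ∑ l, p l • γ l = δ) :
    IsGoodEstimator b e p γ δ (2 * M) := by
  have hM0 : 0 ≤ M := (sum_nonneg fun i _ => mul_nonneg (hp i) (sq_nonneg _)).trans hM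
  refine ⟨fun w hw w' hw' => ?_, fun s hs s' hs' => ?_, fun w _ u _ => ?_⟩
  · calc _ ≤ ∑ i, p i * (e * κ i ^ 2) := sum_le_sum fun i _ => mul_le_mul_of_nonneg_left
          (b.dotProduct_sub_breg_le he (hγ i) hw (b.core_subset_dom (hw' i))) (hp i)
      _ = e * ∑ i, p i * κ i ^ 2 := by
          rw [mul_sum]; exact sum_congr rfl fun i _ => by ring
      _ ≤ e * (2 * M) := mul_le_mul_of_nonneg_left (by linarith) he.le
  · set κ' := ∑ i, p i * κ i with hκ'
    have hκ2 : κ' ^ 2 ≤ M := (sq_mean_le hp hp1 κ).trans hM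
    have hmean : ∀ v : Fin d → ℝ, |(∑ l, p l • γ l) ⬝ᵥ v| ≤ κ' * b.norm v := fun v => by
      rw [sum_dotProduct, hκ', sum_mul]
      refine (abs_sum_le_sum_abs _ _).trans (sum_le_sum fun i _ => ?_)
      rw [smul_dotProduct, smul_eq_mul, abs_mul, abs_of_nonneg (hp i), mul_assoc]
      exact mul_le_mul_of_nonneg_left (hγ i v) (hp i)
    have hdiff : ∀ i, ∀ v : Fin d → ℝ,
        |(∑ l, p l • γ l - γ i) ⬝ᵥ v| ≤ (κ' + κ i) * b.norm v := fun i v => by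
      rw [sub_dotProduct, add_mul]
      exact (abs_sub _ _).trans (add_le_add (hmean v) (hγ i v))
    have e2 : 2 / e = 1 / (e / 2) := by field_simp
    calc _ ≤ ∑ i, p i * (e / 2 * (κ' + κ i) ^ 2) := sum_le_sum fun i _ => by
          rw [e2]
          exact mul_le_mul_of_nonneg_left (b.dotProduct_sub_breg_le (half_pos he) (hdiff i) hs
            (b.core_subset_dom (hs' i))) (hp i)
      -- The halved ghost step compensates for `(κ' + κ i) ^ 2 ≤ 2 * (κ' ^ 2 + κ i ^ 2)`. The two
      -- resulting moments, each at most `M`, account for the `2 * M` of the statement.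
      _ ≤ ∑ i, (e * κ' ^ 2 * p i + e * (p i * κ i ^ 2)) := sum_le_sum fun i _ => by
          nlinarith [mul_nonneg (mul_nonneg he.le (hp i)) (sq_nonneg (κ' - κ i))]
      _ = e * κ' ^ 2 + e * ∑ i, p i * κ i ^ 2 := by
          rw [sum_add_distrib, ← mul_sum, ← mul_sum, hp1, mul_one]
      _ ≤ e * (2 * M) := by nlinarith
  · rw [hδ, sub_self, zero_dotProduct]
    positivity

/-- Clipped estimators in the simplex, with bounded second moments of the entries. -/
theorem isGoodEstimator_of_clipped (he : 0 < e) (hp : ∀ i, 0 ≤ p i) (hp1 : ∑ i, p i = 1)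
    {X : Fin k → Fin d → ℝ} (hγe : ∀ i j, e * |γ i j| ≤ 1) (hγX : ∀ i j, |γ i j| ≤ |X i j|)
    (hXγ : ∀ i j, |X i j - γ i j| ≤ e * X i j ^ 2) {M : ℝ} (hM0 : 0 ≤ M)
    (hM : ∀ j, ∑ i, p i * X i j ^ 2 ≤ M) (hδ : ∑ l, p l • X l = δ) :
    IsGoodEstimator .simplex e p γ δ (2 * M) := by
  have hMγ : ∀ j, ∑ i, p i * γ i j ^ 2 ≤ M := fun j =>
    (sum_le_sum fun i _ => mul_le_mul_of_nonneg_left (sq_le_sq.2 (hγX i j)) (hp i)).trans (hM j)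
  have havg : ∀ w ∈ Block.simplex.core d, ∀ f : Fin k → Fin d → ℝ,
      (∀ j, ∑ i, p i * f i j ≤ M) → ∑ i, p i * ∑ j, w j * f i j ≤ M := by
    intro w hw f hf
    calc _ = ∑ j, w j * ∑ i, p i * f i j := by
          simp only [mul_sum]
          rw [sum_comm]
          exact sum_congr rfl fun j _ => sum_congr rfl fun i _ => by ring
      _ ≤ ∑ j, w j * M := sum_le_sum fun j _ => mul_le_mul_of_nonneg_left (hf j) (hw.2 j).le
      _ = M := by rw [← sum_mul, hw.1.2, one_mul]
  have hmean : ∀ j, (∑ l, p l • γ l) j = ∑ l, p l * γ l j := fun j => by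
    simp [Finset.sum_apply]
  refine ⟨fun w hw w' hw' => ?_, fun s hs s' hs' => ?_, fun w hw u hu => ?_⟩
  · calc _ ≤ ∑ i, p i * (e * ∑ j, w j * γ i j ^ 2) := sum_le_sum fun i _ =>
          mul_le_mul_of_nonneg_left (Block.dotProduct_sub_breg_le_local he (hγe i) hw (hw' i).1)
            (hp i)
      _ = e * ∑ i, p i * ∑ j, w j * γ i j ^ 2 := by
          rw [mul_sum]; exact sum_congr rfl fun i _ => by ring
      _ ≤ e * (2 * M) := mul_le_mul_of_nonneg_left
          ((havg w hw (fun i j => γ i j ^ 2) hMγ).trans (by linarith)) he.le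
  · have hmean_e : ∀ j, e * |∑ l, p l * γ l j| ≤ 1 := fun j => by
      calc e * |∑ l, p l * γ l j| ≤ e * ∑ l, p l * |γ l j| := by
            refine mul_le_mul_of_nonneg_left ((abs_sum_le_sum_abs _ _).trans_eq ?_) he.le
            exact sum_congr rfl fun l _ => by rw [abs_mul, abs_of_nonneg (hp l)]
        _ = ∑ l, p l * (e * |γ l j|) := by
            rw [mul_sum]; exact sum_congr rfl fun i _ => by ring
        _ ≤ ∑ l, p l * 1 := sum_le_sum fun l _ => mul_le_mul_of_nonneg_left (hγe l j) (hp l)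
        _ = 1 := by simp [hp1]
    have e2 : 2 / e = 1 / (e / 2) := by field_simp
    have hdiff : ∀ i j, e / 2 * |(∑ l, p l • γ l - γ i) j| ≤ 1 := fun i j => by
      rw [Pi.sub_apply, hmean]
      have := mul_le_mul_of_nonneg_left (abs_sub (∑ l, p l * γ l j) (γ i j)) he.le
      linarith [hmean_e j, hγe i j]
    have hvar : ∀ j, ∑ i, p i * ((∑ l, p l • γ l - γ i) j) ^ 2 ≤ M := fun j => by
      refine le_trans ?_ (hMγ j)
      simp only [Pi.sub_apply, hmean]
      set m := ∑ l, p l * γ l j with hm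
      have : ∑ i, p i * (m - γ i j) ^ 2 = m ^ 2 * ∑ i, p i - 2 * m * ∑ i, p i * γ i j +
          ∑ i, p i * γ i j ^ 2 := by
        rw [mul_sum, mul_sum, ← sum_sub_distrib, ← sum_add_distrib]
        exact sum_congr rfl fun i _ => by ring
      rw [this, hp1, ← hm]
      nlinarith [sq_nonneg m]
    calc _ ≤ ∑ i, p i * (e / 2 * ∑ j, s j * ((∑ l, p l • γ l - γ i) j) ^ 2) :=
          sum_le_sum fun i _ => by
            rw [e2]
            exact mul_le_mul_of_nonneg_left (Block.dotProduct_sub_breg_le_local (half_pos he)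
              (hdiff i) hs (hs' i).1) (hp i)
      _ = e / 2 * ∑ i, p i * ∑ j, s j * ((∑ l, p l • γ l - γ i) j) ^ 2 := by
          rw [mul_sum]; exact sum_congr rfl fun i _ => by ring
      _ ≤ e / 2 * M := mul_le_mul_of_nonneg_left
          (havg s hs (fun i j => ((∑ l, p l • γ l - γ i) j) ^ 2) hvar) (half_pos he).le
      _ ≤ e * (2 * M) := by nlinarith
  · have hb : ∀ j, |(δ - ∑ l, p l • γ l) j| ≤ e * M := fun j => by
      rw [← hδ, Pi.sub_apply, hmean]
      have : (∑ l, p l • X l) j - ∑ l, p l * γ l j = ∑ l, p l * (X l j - γ l j) := by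
        simp [Finset.sum_apply, ← sum_sub_distrib, mul_sub]
      rw [this]
      calc _ ≤ ∑ l, p l * (e * X l j ^ 2) := (abs_sum_le_sum_abs _ _).trans
            (sum_le_sum fun l _ => by
              rw [abs_mul, abs_of_nonneg (hp l)]
              exact mul_le_mul_of_nonneg_left (hXγ l j) (hp l))
        _ = e * ∑ l, p l * X l j ^ 2 := by
            rw [mul_sum]; exact sum_congr rfl fun i _ => by ring
        _ ≤ e * M := mul_le_mul_of_nonneg_left (hM j) he.le
    -- Each coordinate of the clipping bias is at most `e * M`, and `‖w - u‖₁ ≤ 2`; here the factor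
    -- `2` in `2 * M` is fully used.
    calc _ ≤ ∑ j, e * M * (w j + u j) := sum_le_sum fun j _ => by
          refine (le_abs_self _).trans ?_
          rw [abs_mul]
          refine mul_le_mul (hb j) ?_ (abs_nonneg _) (by positivity)
          rw [Pi.sub_apply]
          refine (abs_sub _ _).trans_eq ?_
          rw [abs_of_nonneg (hw.1.1 j), abs_of_nonneg (hu.1 j)]
      _ = e * (2 * M) := by
          rw [← mul_sum, sum_add_distrib, hw.1.2, hu.2]; ring

end

/-! ## Sampling from a difference -/

/-- The importance weight `δᵢ / pᵢ` computed when sampling index `i` from the difference `δ`. -/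
noncomputable def sampleWeight (b : Block) {k : ℕ} (δ : Fin k → ℝ) (i : Fin k) : ℝ :=
  δ i / ((b.weight (δ i)).eval / ∑ l, (b.weight (δ l)).eval)

/-- The probability of index `i` when sampling from the difference `δ`. -/
noncomputable def sampleProb (b : Block) {k : ℕ} (δ : Fin k → ℝ) (i : Fin k) : ℝ :=
  drawProb (fun l => (b.weight (δ l)).eval) i

theorem Block.weight_eval_nonneg (b : Block) (t : ℝ) : 0 ≤ (b.weight t).eval := by
  cases b
  · exact abs_nonneg t
  · exact mul_self_nonneg t

theorem Block.weight_eval_eq_zero {b : Block} {t : ℝ} : (b.weight t).eval = 0 ↔ t = 0 := by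
  cases b
  · exact abs_eq_zero
  · exact mul_self_eq_zero

theorem drawProb_nonneg {k : ℕ} {w : Fin k → ℝ} (hw : ∀ i, 0 ≤ w i) (i : Fin k) :
    0 ≤ drawProb w i := by
  unfold drawProb
  split_ifs
  · positivity
  · exact div_nonneg (hw i) (sum_nonneg fun l _ => hw l)

theorem sum_drawProb {k : ℕ} (hk : 0 < k) (w : Fin k → ℝ) : ∑ i, drawProb w i = 1 := by
  have hk' : (k : ℝ) ≠ 0 := by exact_mod_cast hk.ne'
  unfold drawProb
  split_ifs with h
  · simp [hk']
  · rw [← sum_div, div_self h]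

section

variable {b : Block} {k : ℕ} (δ : Fin k → ℝ)

theorem sampleProb_nonneg (i : Fin k) : 0 ≤ sampleProb b δ i :=
  drawProb_nonneg (fun _ => b.weight_eval_nonneg _) i

theorem sum_sampleProb (hk : 0 < k) : ∑ i, sampleProb b δ i = 1 := sum_drawProb hk _

/-- This is unbiasedness. It survives zero coordinates, and the uniform draw when `δ = 0`, because
there the importance weight is `0` by the convention for division by zero. -/
theorem sampleProb_mul_sampleWeight (i : Fin k) :
    sampleProb b δ i * sampleWeight b δ i = δ i := by
  unfold sampleProb sampleWeight drawProb
  by_cases hi : δ i = 0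
  · simp [hi]
  · have hwi : (b.weight (δ i)).eval ≠ 0 := fun h => hi (Block.weight_eval_eq_zero.1 h)
    have hs : ∑ l, (b.weight (δ l)).eval ≠ 0 := fun h =>
      hwi ((sum_eq_zero_iff_of_nonneg fun l _ => b.weight_eval_nonneg _).1 h i (mem_univ i))
    rw [if_neg hs]
    field_simp

/-- Second moment of a sampled row, when the rows have norms bounded according to the block. -/
theorem second_moment_le (hk : 0 < k) {L : ℝ} {l : Fin k → ℝ} (hL : 0 ≤ L)
    (hl : match b with
      | .simplex => ∀ i, |l i| ≤ L
      | .ball => ∑ i, l i ^ 2 ≤ L ^ 2) :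
    ∑ i, sampleProb b δ i * (sampleWeight b δ i * l i) ^ 2 ≤ L ^ 2 * b.norm δ ^ 2 := by
  cases b
  · have hw : ∀ i, |sampleWeight .simplex δ i| ≤ ∑ j, |δ j| := fun i => by
      have hs : 0 ≤ ∑ j, |δ j| := sum_nonneg fun j _ => abs_nonneg _
      unfold sampleWeight
      change |δ i / (|δ i| / ∑ j, |δ j|)| ≤ _
      rw [abs_div, abs_div, abs_abs, abs_of_nonneg hs]
      by_cases hi : δ i = 0
      · simpa [hi] using hs
      · have := abs_pos.2 hi
        rw [div_div_eq_mul_div, mul_comm, mul_div_assoc, div_self this.ne', mul_one]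
    calc _ ≤ ∑ i, sampleProb .simplex δ i * (L ^ 2 * (∑ j, |δ j|) ^ 2) :=
          sum_le_sum fun i _ => mul_le_mul_of_nonneg_left (by
            rw [← mul_pow, ← sq_abs, abs_mul, mul_comm]
            exact pow_le_pow_left₀ (by positivity)
              (mul_le_mul (hl i) (hw i) (abs_nonneg _) hL) 2) (sampleProb_nonneg δ i)
      _ = _ := by rw [← sum_mul, sum_sampleProb δ hk, one_mul]; rfl
  · have hs : 0 ≤ ∑ j, δ j ^ 2 := sum_nonneg fun j _ => sq_nonneg _
    have hn : Block.ball.norm δ ^ 2 = ∑ j, δ j ^ 2 := Real.sq_sqrt hs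
    have hw : ∀ i, sampleProb .ball δ i * sampleWeight .ball δ i ^ 2 ≤ ∑ j, δ j ^ 2 := fun i => by
      rw [sq, ← mul_assoc, sampleProb_mul_sampleWeight]
      have e1 : ∀ j, (Block.ball.weight (δ j)).eval = δ j ^ 2 := fun j => (sq (δ j)).symm
      simp only [sampleWeight, e1]
      by_cases hi : δ i = 0
      · simpa [hi] using hs
      · refine le_of_eq ?_
        field_simp
    rw [hn]
    calc _ = ∑ i, sampleProb .ball δ i * sampleWeight .ball δ i ^ 2 * l i ^ 2 :=
          sum_congr rfl fun i _ => by ring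
      _ ≤ ∑ i, (∑ j, δ j ^ 2) * l i ^ 2 :=
          sum_le_sum fun i _ => mul_le_mul_of_nonneg_right (hw i) (sq_nonneg _)
      _ = (∑ j, δ j ^ 2) * ∑ i, l i ^ 2 := by rw [mul_sum]
      _ ≤ L ^ 2 * ∑ j, δ j ^ 2 := by nlinarith

end

/-! ## The matrix constant of a setup -/

theorem abs_dotProduct_le_sqrt {d : ℕ} (a v : Fin d → ℝ) :
    |a ⬝ᵥ v| ≤ √(∑ i, a i ^ 2) * √(∑ i, v i ^ 2) := by
  rw [← Real.sqrt_mul (sum_nonneg fun i _ => sq_nonneg _)]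
  exact Real.abs_le_sqrt (sum_mul_sq_le_sq_mul_sq univ a v)

theorem abs_dotProduct_le_of_abs_le {d : ℕ} {a : Fin d → ℝ} {L : ℝ} (ha : ∀ i, |a i| ≤ L)
    (v : Fin d → ℝ) : |a ⬝ᵥ v| ≤ L * ∑ i, |v i| := by
  rw [mul_sum]
  refine (abs_sum_le_sum_abs _ _).trans (sum_le_sum fun i _ => ?_)
  rw [abs_mul]
  exact mul_le_mul_of_nonneg_right (ha i) (abs_nonneg _)

section

variable {n m : ℕ} (A : Matrix (Fin m) (Fin n) ℝ)

theorem abs_le_matConst_l1l1 (i : Fin m) (j : Fin n) : |A i j| ≤ Setup.l1l1.matConst A :=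
  (le_ciSup (f := fun j => |A i j|) (Set.finite_range _).bddAbove j).trans
    (le_ciSup (f := fun i => ⨆ j, |A i j|) (Set.finite_range _).bddAbove i)

theorem sqrt_row_le_matConst_l2l1 (i : Fin m) : √(∑ j, A i j ^ 2) ≤ Setup.l2l1.matConst A :=
  le_ciSup (f := fun i => √(∑ j, A i j ^ 2)) (Set.finite_range _).bddAbove i

theorem sq_matConst_l2l2 : Setup.l2l2.matConst A ^ 2 = ∑ i, ∑ j, A i j ^ 2 :=
  Real.sq_sqrt (sum_nonneg fun _ _ => sum_nonneg fun _ _ => sq_nonneg _)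

theorem matConst_nonneg (S : Setup) : 0 ≤ S.matConst A := by
  cases S
  · exact Real.iSup_nonneg fun i => Real.iSup_nonneg fun j => abs_nonneg _
  · exact Real.iSup_nonneg fun i => Real.sqrt_nonneg _
  · exact Real.sqrt_nonneg _

theorem abs_entry_le_matConst (S : Setup) (i : Fin m) (j : Fin n) : |A i j| ≤ S.matConst A := by
  have h1 : A i j ^ 2 ≤ ∑ j, A i j ^ 2 :=
    single_le_sum (f := fun j => A i j ^ 2) (fun _ _ => sq_nonneg _) (mem_univ j)
  cases S
  · exact abs_le_matConst_l1l1 A i j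
  · exact (Real.abs_le_sqrt h1).trans (sqrt_row_le_matConst_l2l1 A i)
  · exact Real.abs_le_sqrt (h1.trans (single_le_sum (f := fun i => ∑ j, A i j ^ 2)
      (fun _ _ => sum_nonneg fun _ _ => sq_nonneg _) (mem_univ i)))

theorem abs_bilin_le (S : Setup) (x : Fin n → ℝ) (y : Fin m → ℝ) :
    |y ⬝ᵥ A.mulVec x| ≤ S.matConst A * S.yBlock.norm y * S.xBlock.norm x := by
  have hL := matConst_nonneg A S
  rw [dotProduct_comm, mul_right_comm]
  cases S
  · exact abs_dotProduct_le_of_abs_le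
      (fun i => abs_dotProduct_le_of_abs_le (abs_le_matConst_l1l1 A i) x) y
  · refine abs_dotProduct_le_of_abs_le (fun i => (abs_dotProduct_le_sqrt _ _).trans ?_) y
    exact mul_le_mul_of_nonneg_right (sqrt_row_le_matConst_l2l1 A i) (Real.sqrt_nonneg _)
  · refine (abs_dotProduct_le_sqrt _ _).trans ?_
    refine mul_le_mul_of_nonneg_right ?_ (Real.sqrt_nonneg _)
    refine Real.sqrt_le_iff.2 ⟨mul_nonneg hL (Real.sqrt_nonneg _), ?_⟩
    have hx : 0 ≤ ∑ j, x j ^ 2 := sum_nonneg fun _ _ => sq_nonneg _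
    change _ ≤ (_ * √(∑ j, x j ^ 2)) ^ 2
    rw [mul_pow, sq_matConst_l2l2, Real.sq_sqrt hx, sum_mul]
    exact sum_le_sum fun i _ => sum_mul_sq_le_sq_mul_sq univ (A i) x

/-- The estimator of `Aᵀ δ` by a sampled row. -/
theorem isGoodEstimator_row (S : Setup) (hm : 0 < m) {e : ℝ} (he : 0 < e) (δ : Fin m → ℝ) :
    IsGoodEstimator S.xBlock e (sampleProb S.yBlock δ)
      (fun i j => A i j * sampleWeight S.yBlock δ i) (fun j => ∑ i, A i j * δ i)
      (2 * (S.matConst A ^ 2 * S.yBlock.norm δ ^ 2)) := by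
  have hL := matConst_nonneg A S
  have hdot : ∀ i v, (fun j => A i j * sampleWeight S.yBlock δ i) ⬝ᵥ v =
      sampleWeight S.yBlock δ i * (A i ⬝ᵥ v) := fun i v => by
    rw [← smul_eq_mul, ← smul_dotProduct]
    congr 1
    ext j
    simp [mul_comm]
  -- `l i` bounds the dual norm of row `i`; the sampling block decides whether its maximum or its
  -- sum of squares has to be controlled by `L`.
  obtain ⟨l, hl0, hl1, hl2⟩ : ∃ l : Fin m → ℝ, (∀ i, 0 ≤ l i) ∧
      (∀ i, ∀ v, |A i ⬝ᵥ v| ≤ l i * S.xBlock.norm v) ∧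
      (match S.yBlock with
        | .simplex => ∀ i, |l i| ≤ S.matConst A
        | .ball => ∑ i, l i ^ 2 ≤ S.matConst A ^ 2) := by
    cases S
    · exact ⟨fun _ => _, fun _ => hL,
        fun i v => abs_dotProduct_le_of_abs_le (abs_le_matConst_l1l1 A i) v,
        fun i => (abs_of_nonneg hL).le⟩
    · exact ⟨fun i => √(∑ j, A i j ^ 2), fun _ => Real.sqrt_nonneg _,
        fun i v => abs_dotProduct_le_sqrt _ _,
        fun i => (abs_of_nonneg (Real.sqrt_nonneg _)).trans_le (sqrt_row_le_matConst_l2l1 A i)⟩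
    · refine ⟨fun i => √(∑ j, A i j ^ 2), fun _ => Real.sqrt_nonneg _,
        fun i v => abs_dotProduct_le_sqrt _ _, ?_⟩
      change _ ≤ _
      rw [sq_matConst_l2l2]
      exact sum_le_sum fun i _ => (Real.sq_sqrt (sum_nonneg fun _ _ => sq_nonneg _)).le
  refine isGoodEstimator_of_unbiased he (sampleProb_nonneg δ) (sum_sampleProb δ hm)
    (κ := fun i => |sampleWeight S.yBlock δ i * l i|) (fun i v => ?_) ?_ ?_
  · rw [hdot, abs_mul, abs_mul, mul_assoc, abs_of_nonneg (hl0 i)]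
    exact mul_le_mul_of_nonneg_left (hl1 i v) (abs_nonneg _)
  · simp only [sq_abs]
    exact second_moment_le δ hm hL hl2
  · ext j
    simp only [Finset.sum_apply, Pi.smul_apply, smul_eq_mul]
    exact sum_congr rfl fun i _ => by rw [mul_left_comm, sampleProb_mul_sampleWeight]

theorem abs_clip_le {τ : ℝ} (hτ : 0 ≤ τ) (x : ℝ) : |max (-τ) (min τ x)| ≤ τ :=
  abs_le.2 ⟨le_max_left _ _, max_le (by linarith) (min_le_left _ _)⟩

theorem abs_clip_le_abs {τ : ℝ} (hτ : 0 ≤ τ) (x : ℝ) : |max (-τ) (min τ x)| ≤ |x| := by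
  rw [abs_le]
  constructor
  · exact (le_min (by linarith [abs_nonneg x]) (neg_abs_le x)).trans (le_max_right _ _)
  · exact max_le (by linarith [abs_nonneg x]) ((min_le_right _ _).trans (le_abs_self x))

/-- The error is nonzero only where `|x| ≥ τ`, and there it is at most `|x| ≤ x ^ 2 / τ`. Thus a
second moment controls the bias. -/
theorem abs_sub_clip_le {τ : ℝ} (hτ : 0 < τ) (x : ℝ) :
    |x - max (-τ) (min τ x)| ≤ 1 / τ * x ^ 2 := by
  have h0 : 0 ≤ 1 / τ * x ^ 2 := by positivity
  have key : ∀ y : ℝ, τ ≤ y → y - τ ≤ 1 / τ * y ^ 2 := fun y hy => by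
    rw [div_mul_eq_mul_div, one_mul, le_div_iff₀ hτ]
    nlinarith
  rcases le_total x (-τ) with h | h
  · rw [min_eq_right (by linarith), max_eq_left h, abs_of_nonpos (by linarith)]
    have := key (-x) (by linarith)
    rw [neg_sq] at this
    linarith
  · rcases le_total x τ with h' | h'
    · rw [min_eq_right h', max_eq_right h, sub_self, abs_zero]
      exact h0
    · rw [min_eq_left h', max_eq_right (by linarith), abs_of_nonneg (by linarith)]
      exact key x h'

/-- The estimator of `-A δ` by a sampled (possibly clipped) column. -/
theorem isGoodEstimator_col (S : Setup) (hn : 0 < n) {η ρ : ℝ} (he : 0 < η * ρ) (δ : Fin n → ℝ) :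
    IsGoodEstimator S.yBlock (η * ρ) (sampleProb S.xBlock δ)
      (fun j i => -(trunc (Problem.truncLevel η ρ S)
        (.val (A i j) * .val (sampleWeight S.xBlock δ j))).eval)
      (fun i => -∑ j, A i j * δ j)
      (2 * (S.matConst A ^ 2 * S.xBlock.norm δ ^ 2)) := by
  have hL := matConst_nonneg A S
  have hmean : ∀ b : Block, ∑ j, sampleProb b δ j • (fun i => -(A i j * sampleWeight b δ j)) =
      fun i => -∑ j, A i j * δ j := fun b => by
    ext i
    simp only [Finset.sum_apply, Pi.smul_apply, smul_eq_mul, mul_neg, sum_neg_distrib]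
    congr 1
    exact sum_congr rfl fun j _ => by rw [mul_left_comm, sampleProb_mul_sampleWeight]
  have hdot : ∀ (b : Block) (j : Fin n) (v : Fin m → ℝ),
      (fun i => -(A i j * sampleWeight b δ j)) ⬝ᵥ v =
      -(sampleWeight b δ j * ((fun i => A i j) ⬝ᵥ v)) := fun b j v => by
    rw [← smul_eq_mul, ← smul_dotProduct, ← neg_dotProduct]
    congr 1
    ext j
    simp [mul_comm]
  cases S
  · refine isGoodEstimator_of_unbiased he (sampleProb_nonneg δ) (sum_sampleProb δ hn)
      (κ := fun j => |sampleWeight .simplex δ j * Setup.l1l1.matConst A|)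
      (fun j v => ?_) ?_ (hmean .simplex)
    · refine (congrArg abs (hdot .simplex j v)).trans_le ?_
      rw [abs_neg, abs_mul, abs_mul, mul_assoc, abs_of_nonneg hL]
      exact mul_le_mul_of_nonneg_left
        (abs_dotProduct_le_of_abs_le (fun i => abs_le_matConst_l1l1 A i j) v) (abs_nonneg _)
    · simp only [sq_abs]
      exact second_moment_le (b := .simplex) δ hn hL fun i => (abs_of_nonneg hL).le
  -- With ℓ₂ sampling each row of `A` controls the second moment of one entry, but the maximum over
  -- the entries of a sampled column need not have second moment of order `L ^ 2`; hence the clipped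
  -- criterion.
  · have hτ : 0 < 1 / (η * ρ) := by positivity
    have hclip : ∀ (j : Fin n) (i : Fin m), (trunc (Problem.truncLevel η ρ .l2l1)
        (.val (A i j) * .val (sampleWeight .ball δ j))).eval =
        max (-(1 / (η * ρ))) (min (1 / (η * ρ)) (A i j * sampleWeight .ball δ j)) :=
      fun _ _ => rfl
    refine isGoodEstimator_of_clipped he (sampleProb_nonneg δ) (sum_sampleProb δ hn)
      (X := fun j i => -(A i j * sampleWeight .ball δ j)) (fun j i => ?_) (fun j i => ?_)
      (fun j i => ?_) (by positivity) (fun i => ?_) (hmean .ball)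
    · have := mul_le_mul_of_nonneg_left
        (abs_clip_le hτ.le (A i j * sampleWeight .ball δ j)) he.le
      rw [mul_one_div_cancel he.ne'] at this
      rw [abs_neg]
      exact this
    · rw [abs_neg, abs_neg]
      exact abs_clip_le_abs hτ.le _
    · have := abs_sub_clip_le hτ (A i j * sampleWeight .ball δ j)
      rw [one_div_one_div, ← abs_neg] at this
      rw [neg_sq]
      refine le_trans (le_of_eq (congrArg abs ?_)) this
      rw [neg_sub, sub_neg_eq_add, neg_add_eq_sub]
      rfl
    · have hrow : ∑ j, A i j ^ 2 ≤ Setup.l2l1.matConst A ^ 2 :=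
        (Real.sqrt_le_left hL).1 (sqrt_row_le_matConst_l2l1 A i)
      refine le_trans (le_of_eq ?_) (second_moment_le (b := .ball) δ hn hL (l := A i) hrow)
      exact sum_congr rfl fun j _ => by
        rw [neg_sq, mul_comm (A i j)]
        rfl
  · refine isGoodEstimator_of_unbiased he (sampleProb_nonneg δ) (sum_sampleProb δ hn)
      (κ := fun j => |sampleWeight .ball δ j * √(∑ i, A i j ^ 2)|)
      (fun j v => ?_) ?_ (hmean .ball)
    · refine (congrArg abs (hdot .ball j v)).trans_le ?_
      rw [abs_neg, abs_mul, abs_mul, mul_assoc, abs_of_nonneg (Real.sqrt_nonneg _)]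
      exact mul_le_mul_of_nonneg_left (abs_dotProduct_le_sqrt _ _) (abs_nonneg _)
    · simp only [sq_abs]
      refine second_moment_le (b := .ball) δ hn hL ?_
      change _ ≤ _
      rw [sq_matConst_l2l2, sum_comm]
      exact sum_le_sum fun i _ => (Real.sq_sqrt (sum_nonneg fun _ _ => sq_nonneg _)).le

end

/-! ## Semantics of programs -/

namespace RealExpr

theorem eval_foldr {ι : Type} (l : List ι) (f : ι → RealExpr) :
    (l.foldr (fun i acc => f i + acc) (val 0)).eval = (l.map fun i => (f i).eval).sum := by
  induction l with
  | nil => rfl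
  | cons a l ih => simp only [List.foldr_cons, List.map_cons, List.sum_cons, ← ih]; rfl

theorem eval_sum {ι : Type} (s : Finset ι) (f : ι → RealExpr) :
    (sum s f).eval = ∑ i ∈ s, (f i).eval := by
  rw [sum, eval_foldr, Finset.sum_map_toList]

theorem ops_foldr {ι : Type} (l : List ι) (f : ι → RealExpr) :
    (l.foldr (fun i acc => f i + acc) (val 0)).ops = (l.map fun i => (f i).ops + 1).sum := by
  induction l with
  | nil => rfl
  | cons a l ih =>
    simp only [List.foldr_cons, List.map_cons, List.sum_cons, ← ih]
    change _ + _ + 1 = _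
    ring

theorem ops_sum {ι : Type} (s : Finset ι) (f : ι → RealExpr) :
    (sum s f).ops = ∑ i ∈ s, ((f i).ops + 1) := by
  rw [sum, ops_foldr, Finset.sum_map_toList]

end RealExpr

namespace Comp

variable {α β γ : Type}

theorem bind_assoc (p : Comp α) (f : α → Comp β) (g : β → Comp γ) :
    (p.bind f).bind g = p.bind fun a => (f a).bind g := by
  induction p with
  | ret a => rfl
  | spend c p ih => simp only [bind, ih]
  | draw w next ih => simp only [bind, ih]

theorem mean_bind (p : Comp α) (g : α → Comp β) (f : β → ℝ) :
    (p.bind g).mean f = p.mean fun a => (g a).mean f := by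
  induction p with
  | ret a => rfl
  | spend c p ih => simpa only [bind, mean] using ih
  | draw w next ih => simp only [bind, mean, ih]

theorem time_bind_le {p : Comp α} {g : α → Comp β} {a b : ℕ} (hp : p.time ≤ a)
    (hg : ∀ x, (g x).time ≤ b) : (p.bind g).time ≤ a + b := by
  have key : (p.bind g).time ≤ p.time + b := by
    clear hp
    induction p with
    | ret a => simpa [bind, time] using hg a
    | spend c p ih => simp only [bind, time]; omega
    | draw w next ih =>
      simp only [bind, time, add_assoc]
      refine Nat.add_le_add_left (Finset.sup_le fun i _ => (ih i).trans ?_) _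
      exact Nat.add_le_add_right (Finset.le_sup (f := fun i => (next i).time) (mem_univ i)) _
  omega

theorem always_bind {p : Comp α} {g : α → Comp β} {Q : α → Prop} {R : β → Prop}
    (hp : p.Always Q) (hg : ∀ a, Q a → (g a).Always R) : (p.bind g).Always R := by
  induction p with
  | ret a => exact hg a hp
  | spend c p ih => exact ih hp
  | draw w next ih => exact fun i => ih i (hp i)

theorem Always.mono {p : Comp α} {Q R : α → Prop} (hp : p.Always Q) (h : ∀ a, Q a → R a) :
    p.Always R := by
  induction p with
  | ret a => exact h a hp
  | spend c p ih => exact ih hp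
  | draw w next ih => exact fun i => ih i (hp i)

/-- All draws are made with nonnegative weights from nonempty index sets. -/
def Proper : Comp α → Prop
  | ret _ => True
  | spend _ p => p.Proper
  | draw (k := k) w next => 0 < k ∧ (∀ i, 0 ≤ w i) ∧ ∀ i, (next i).Proper

theorem proper_bind {p : Comp α} {g : α → Comp β} (hp : p.Proper)
    (hg : ∀ a, (g a).Proper) : (p.bind g).Proper := by
  induction p with
  | ret a => exact hg a
  | spend c p ih => exact ih hp
  | draw w next ih => exact ⟨hp.1, hp.2.1, fun i => ih i (hp.2.2 i)⟩

theorem mean_mono {p : Comp α} (hp : p.Proper) {Q : α → Prop} (hQ : p.Always Q) {f g : α → ℝ}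
    (h : ∀ a, Q a → f a ≤ g a) : p.mean f ≤ p.mean g := by
  induction p with
  | ret a => exact h a hQ
  | spend c p ih => exact ih hp hQ
  | draw w next ih =>
    exact sum_le_sum fun i _ => mul_le_mul_of_nonneg_left (ih i (hp.2.2 i) (hQ i))
      (drawProb_nonneg hp.2.1 i)

/-- Properness excludes draws from an empty index set, so the total probability is `1` and constants
pass through the mean. -/
theorem mean_mul_add {p : Comp α} (hp : p.Proper) (a b : ℝ) (f : α → ℝ) :
    p.mean (fun x => a * f x + b) = a * p.mean f + b := by
  induction p with
  | ret a => rfl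
  | spend c p ih => exact ih hp
  | draw w next ih =>
    simp only [mean]
    rw [mul_sum]
    nth_rw 2 [← one_mul b]
    rw [← sum_drawProb hp.1 w, sum_mul, ← sum_add_distrib]
    refine sum_congr rfl fun i _ => ?_
    rw [ih i (hp.2.2 i)]
    ring

theorem proper_iterate {f : α → Comp α} (hf : ∀ a, (f a).Proper) (k : ℕ) (a : α) :
    (iterate f k a).Proper := by
  induction k generalizing a with
  | zero => trivial
  | succ k ih => exact proper_bind (hf a) ih

theorem always_iterate {f : α → Comp α} {Q : α → Prop} (hf : ∀ a, Q a → (f a).Always Q) (k : ℕ)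
    {a : α} (ha : Q a) : (iterate f k a).Always Q := by
  induction k generalizing a with
  | zero => exact ha
  | succ k ih => exact always_bind (hf a ha) fun b hb => ih hb

theorem time_iterate_le {f : α → Comp α} {c : ℕ} (hf : ∀ a, (f a).time ≤ c) (k : ℕ) (a : α) :
    (iterate f k a).time ≤ k * c := by
  induction k generalizing a with
  | zero => exact Nat.zero_le _
  | succ k ih =>
    rw [Nat.succ_mul, add_comm (k * c)]
    exact time_bind_le (hf a) ih

theorem time_vec_le {d c : ℕ} {e : Fin d → RealExpr} (h : ∀ i, (e i).ops + 1 ≤ c) :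
    (vec e).time ≤ c * d := by
  change ∑ i, ((e i).ops + 1) + 0 ≤ _
  rw [add_zero]
  refine (Finset.sum_le_card_nsmul _ _ c fun i _ => h i).trans_eq ?_
  simp [mul_comm]

end Comp

/-! ## The algorithm as a random iteration -/

namespace Problem

variable {n m : ℕ} (P : Problem n m) (S : Setup)

/-- The gradient mapping `g(z) = (Aᵀ y, -A x)`. -/
noncomputable def bilinGrad (z : Pt n m) : Pt n m :=
  (fun j => ∑ i, P.A i j * z.2 i, fun i => -∑ j, P.A i j * z.1 j)

theorem mean_exactGrad_bind {β : Type} (z : Pt n m) (g : Pt n m → Comp β) (f : β → ℝ) :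
    ((P.exactGrad z).bind g).mean f = (g (P.bilinGrad z)).mean f := by
  have e : P.bilinGrad z = (open Classical in
      ((fun j => (RealExpr.sum {i | P.A i j ≠ 0} fun i => .val (P.A i j) * .val (z.2 i)).eval,
      fun i => (-(RealExpr.sum {j | P.A i j ≠ 0} fun j =>
        .val (P.A i j) * .val (z.1 j)) : RealExpr).eval) : Pt n m)) := by
    refine Prod.ext (funext fun j => ?_) (funext fun i => ?_)
    · dsimp only [bilinGrad]
      rw [RealExpr.eval_sum, sum_filter]
      refine sum_congr rfl fun i _ => ?_
      split_ifs with h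
      · rfl
      · rw [not_not.1 h, zero_mul]
    · change -_ = -(RealExpr.eval _)
      rw [RealExpr.eval_sum, sum_filter]
      congr 1
      refine sum_congr rfl fun j _ => ?_
      split_ifs with h
      · rfl
      · rw [not_not.1 h, zero_mul]
  rw [e]
  rfl

theorem proper_exactGrad (z : Pt n m) : (P.exactGrad z).Proper := trivial

theorem nnz_eq_sum_col [∀ i j, Decidable (P.A i j ≠ 0)] :
    nnz P.A = ∑ j, #{i | P.A i j ≠ 0} := by
  classical
  rw [nnz, Set.ncard_eq_toFinset_card', Set.toFinset_ofPred, card_filter, Fintype.sum_prod_type,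
    sum_comm]
  refine sum_congr rfl fun j _ => ?_
  rw [card_filter]

theorem nnz_eq_sum_row [∀ i j, Decidable (P.A i j ≠ 0)] :
    nnz P.A = ∑ i, #{j | P.A i j ≠ 0} := by
  classical
  rw [nnz, Set.ncard_eq_toFinset_card', Set.toFinset_ofPred, card_filter, Fintype.sum_prod_type]
  refine sum_congr rfl fun j _ => ?_
  rw [card_filter]

theorem time_exactGrad_le (z : Pt n m) :
    (P.exactGrad z).time ≤ 4 * nnz P.A + 2 * (m + n) := by
  classical
  have e1 : ∀ (k : ℕ) (s : Finset (Fin k)) (a b : Fin k → ℝ),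
      (RealExpr.sum s fun i => .val (a i) * .val (b i)).ops = 2 * #s := fun k s a b => by
    rw [RealExpr.ops_sum]
    change ∑ i ∈ s, (0 + 0 + 1 + 1) = _
    simp [mul_comm]
  have e2 : ∀ a : RealExpr, (-a).ops = a.ops + 1 := fun _ => rfl
  change ∑ _, (_ + 1) + (∑ _, (_ + 1) + 0) ≤ _
  simp only [e1, e2, add_assoc, sum_add_distrib, ← mul_sum]
  have h1 := P.nnz_eq_sum_col
  have h2 := P.nnz_eq_sum_row
  simp only [← h1, sum_const, card_univ, Fintype.card_fin, smul_eq_mul]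
  rw [← h2]
  omega

section sampleDiff

variable {b : Block} {d : ℕ} {β : Type} (w w₀ : Fin d → ℝ) (g : Fin d × ℝ → Comp β)

theorem mean_sampleDiff_bind (f : β → ℝ) :
    ((sampleDiff b w w₀).bind g).mean f =
      ∑ i, sampleProb b (w - w₀) i * (g (i, sampleWeight b (w - w₀) i)).mean f := by
  change ∑ i, _ * (g (i, (w i - w₀ i) / ((b.weight (w i - w₀ i)).eval / RealExpr.eval _))).mean f
    = _
  rw [RealExpr.eval_sum]
  rfl

theorem proper_sampleDiff (hd : 0 < d) : (sampleDiff b w w₀).Proper :=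
  ⟨hd, fun _ => b.weight_eval_nonneg _, fun _ => trivial⟩

theorem time_sampleDiff_le : (sampleDiff b w w₀).time ≤ 6 * d + 4 := by
  have hw : ∀ t, (b.weight t).ops + 1 ≤ 2 := fun t => by cases b <;> exact le_rfl
  refine (Comp.time_bind_le (Comp.time_vec_le (c := 2) fun i => le_rfl) fun δ =>
    Comp.time_bind_le (Comp.time_vec_le (c := 2) fun i => hw _) fun p =>
    Comp.time_bind_le (a := d + 1) ?_ fun s =>
    Comp.time_bind_le (a := d) ?_ fun i => (?_ : _ ≤ 3)).trans ?_
  · change RealExpr.ops _ + 1 + 0 ≤ _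
    rw [RealExpr.ops_sum]
    change ∑ i, (0 + 1) + 1 + 0 ≤ _
    simp
  · change d + univ.sup (fun _ => 0) ≤ d
    simp
  · exact le_rfl
  · omega

end sampleDiff

/-- The `x`-block of an inner iterate after row `i` has been sampled. -/
noncomputable def innerX (q : Params) (ρ : ℝ) (w₀ g₀ w : Pt n m) (i : Fin m) : Fin n → ℝ :=
  argminOn (S.xBlock.dom n) (fun x =>
    (fun j => g₀.1 j + P.A i j * sampleWeight S.yBlock (w.2 - w₀.2) i) ⬝ᵥ x + P.φ x +
      q.α / 2 * ρ * S.xBlock.breg w₀.1 x + 1 / q.η * ρ * S.xBlock.breg w.1 x)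

/-- The `y`-block of an inner iterate after column `j` has been sampled. -/
noncomputable def innerY (q : Params) (ρ : ℝ) (w₀ g₀ w : Pt n m) (j : Fin n) : Fin m → ℝ :=
  argminOn (S.yBlock.dom m) (fun y =>
    (fun i => g₀.2 i - (trunc (truncLevel q.η ρ S)
      (.val (P.A i j) * .val (sampleWeight S.xBlock (w.1 - w₀.1) j))).eval) ⬝ᵥ y + P.ψ y +
      q.α / 2 * (1 / ρ) * S.yBlock.breg w₀.2 y + 1 / q.η * (1 / ρ) * S.yBlock.breg w.2 y)

/-- The point after an outer step from `z`, given the average `v` of the inner iterates. -/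
noncomputable def outerPoint (q : Params) (μ ρ : ℝ) (z v : Pt n m) : Pt n m :=
  (argminOn (S.xBlock.dom n) (fun x => (fun j => (P.bilinGrad v).1 j + P.gradφ v.1 j) ⬝ᵥ x +
      0 + q.α * ρ * S.xBlock.breg z.1 x + μ * ρ * S.xBlock.breg v.1 x),
    argminOn (S.yBlock.dom m) (fun y => (fun i => (P.bilinGrad v).2 i + P.gradψ v.2 i) ⬝ᵥ y +
      0 + q.α * (1 / ρ) * S.yBlock.breg z.2 y + μ * (1 / ρ) * S.yBlock.breg v.2 y))

variable (q : Params) (ρ : ℝ) (w₀ g₀ : Pt n m)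

/-- Row `i` affects only the `x`-block and column `j` only the `y`-block, so the analysis splits
over blocks. -/
theorem mean_innerStep (s : Pt n m × Pt n m) (f : Pt n m × Pt n m → ℝ) :
    (P.innerStep S q ρ w₀ g₀ s).mean f =
      ∑ i, sampleProb S.yBlock (s.1.2 - w₀.2) i * ∑ j, sampleProb S.xBlock (s.1.1 - w₀.1) j *
        f ((P.innerX S q ρ w₀ g₀ s.1 i, P.innerY S q ρ w₀ g₀ s.1 j),
          (s.2.1 + P.innerX S q ρ w₀ g₀ s.1 i, s.2.2 + P.innerY S q ρ w₀ g₀ s.1 j)) := by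
  change ((Comp.bind (Comp.bind _ _) _).mean f) = _
  rw [Comp.bind_assoc, mean_sampleDiff_bind]
  refine sum_congr rfl fun i _ => ?_
  congr 1
  change ((Comp.bind (Comp.bind _ _) _).mean f) = _
  rw [Comp.bind_assoc, mean_sampleDiff_bind]
  rfl

theorem proper_innerStep (hn : 0 < n) (hm : 0 < m) (s : Pt n m × Pt n m) :
    (P.innerStep S q ρ w₀ g₀ s).Proper :=
  Comp.proper_bind (Comp.proper_bind (proper_sampleDiff _ _ hm) fun _ =>
    Comp.proper_bind (proper_sampleDiff _ _ hn) fun _ => trivial) fun _ => trivial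

theorem time_innerStep_le (hm : 0 < m) (s : Pt n m × Pt n m) :
    (P.innerStep S q ρ w₀ g₀ s).time ≤ 40 * (m + n) := by
  have ht : ∀ x y : ℝ, (trunc (truncLevel q.η ρ S) (.val x * .val y)).ops ≤ 3 := fun x y => by
    cases S
    exacts [Nat.le_of_ble_eq_true rfl, Nat.le_of_ble_eq_true rfl, Nat.le_of_ble_eq_true rfl]
  refine (Comp.time_bind_le (b := 3 * (m + n) + 16)
    (Comp.time_bind_le (time_sampleDiff_le _ _) fun r =>
    Comp.time_bind_le (time_sampleDiff_le _ _) fun c =>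
    Comp.time_bind_le (Comp.time_vec_le (c := 3) fun i => le_rfl) fun gx =>
    Comp.time_bind_le (b := 0) (Comp.time_vec_le (c := 5) fun i => ?_) fun gy => le_rfl)
    fun g => ?_).trans ?_
  · have := ht (P.A i c.1) c.2
    change 0 + RealExpr.ops _ + 1 + 1 ≤ 5
    omega
  · refine (Comp.time_bind_le (a := 3) le_rfl fun _ => Comp.time_bind_le (a := 3) le_rfl fun _ =>
      Comp.time_bind_le (a := 4) le_rfl fun _ => Comp.time_bind_le (a := 4) le_rfl fun _ =>
      Comp.time_bind_le (a := n) le_rfl fun _ => Comp.time_bind_le (a := m) le_rfl fun _ =>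
      Comp.time_bind_le (Comp.time_vec_le (c := 2) fun i => le_rfl) fun _ =>
      Comp.time_bind_le (b := 0) (Comp.time_vec_le (c := 2) fun i => le_rfl)
        fun _ => le_rfl).trans ?_
    omega
  · omega

theorem mean_innerLoop_bind {β : Type} (g : Pt n m → Comp β) (f : β → ℝ) :
    ((P.innerLoop S q ρ w₀).bind g).mean f =
      (Comp.iterate (P.innerStep S q ρ w₀ (P.bilinGrad w₀)) q.T (w₀, (0, 0))).mean fun s =>
        (g (fun j => s.2.1 j / q.T, fun i => s.2.2 i / q.T)).mean f := by
  change ((Comp.bind (Comp.bind _ _) _).mean f) = _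
  rw [Comp.bind_assoc, mean_exactGrad_bind]
  change ((Comp.bind (Comp.bind _ _) _).mean f) = _
  rw [Comp.bind_assoc, Comp.mean_bind]
  rfl

theorem mean_outerStep (μ : ℝ) (z : Pt n m) (f : Pt n m → ℝ) :
    (P.outerStep S q μ ρ z).mean f =
      (Comp.iterate (P.innerStep S q ρ z (P.bilinGrad z)) q.T (z, (0, 0))).mean fun s =>
        f (P.outerPoint S q μ ρ z (fun j => s.2.1 j / q.T, fun i => s.2.2 i / q.T)) := by
  change ((Comp.bind _ _).mean f) = _
  rw [mean_innerLoop_bind]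
  congr 1
  funext s
  change ((Comp.bind _ _).mean f) = _
  rw [mean_exactGrad_bind]
  rfl

theorem proper_outerStep (hn : 0 < n) (hm : 0 < m) (μ : ℝ) (z : Pt n m) :
    (P.outerStep S q μ ρ z).Proper :=
  Comp.proper_bind (Comp.proper_bind (P.proper_exactGrad z) fun _ => Comp.proper_bind
    (Comp.proper_iterate (P.proper_innerStep S q ρ _ _ hn hm) _ _) fun _ => trivial) fun v =>
    Comp.proper_bind (P.proper_exactGrad v) fun _ => trivial

theorem time_outerStep_le (hm : 0 < m) (μ : ℝ) (z : Pt n m) :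
    (P.outerStep S q μ ρ z).time ≤ 8 * nnz P.A + 40 * (q.T * (m + n)) + 30 * (m + n) := by
  refine (Comp.time_bind_le (Comp.time_bind_le (P.time_exactGrad_le z) fun _ =>
    Comp.time_bind_le (Comp.time_iterate_le (P.time_innerStep_le S q ρ _ _ hm) _ _) fun _ =>
    Comp.time_bind_le (Comp.time_vec_le (c := 2) fun i => le_rfl) fun _ =>
    Comp.time_bind_le (b := 0) (Comp.time_vec_le (c := 2) fun i => le_rfl) fun _ => le_rfl) fun v =>
    Comp.time_bind_le (P.time_exactGrad_le v) fun _ =>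
    Comp.time_bind_le (a := n) le_rfl fun _ => Comp.time_bind_le (a := m) le_rfl fun _ =>
    Comp.time_bind_le (Comp.time_vec_le (c := 2) fun i => le_rfl) fun _ =>
    Comp.time_bind_le (Comp.time_vec_le (c := 2) fun i => le_rfl) fun _ =>
    Comp.time_bind_le (a := 2) le_rfl fun _ => Comp.time_bind_le (a := 2) le_rfl fun _ =>
    Comp.time_bind_le (a := 3) le_rfl fun _ => Comp.time_bind_le (a := 3) le_rfl fun _ =>
    Comp.time_bind_le (a := n) le_rfl fun _ => Comp.time_bind_le (a := m) (b := 0) le_rfl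
      fun _ => le_rfl).trans ?_
  have e : q.T * (40 * (m + n)) = 40 * (q.T * (m + n)) := by ring
  rw [e]
  omega

theorem time_fullLoop_le (hm : 0 < m) (μx μy : ℝ) :
    (P.fullLoop S μx μy q).time ≤
      m + n + q.K * (8 * nnz P.A + 40 * (q.T * (m + n)) + 30 * (m + n)) := by
  refine (Comp.time_bind_le (a := n) le_rfl fun _ => Comp.time_bind_le (a := m) le_rfl fun _ =>
    Comp.time_iterate_le (P.time_outerStep_le S q _ hm _) _ _).trans ?_
  omega

end Problem

/-! ## The inner loop -/

/-- One stochastic mirror step in a block, with a ghost mirror step that absorbs the noise. -/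
theorem stochastic_mirror_step {b : Block} {d k : ℕ} {h : (Fin d → ℝ) → ℝ}
    {h' : (Fin d → ℝ) → Fin d → ℝ} (H : IsConvexTerm b h h') (hd : 0 < d) {e a a' v : ℝ}
    (he : 0 < e) (ha : 0 ≤ a) (ha' : a' = 1 / e) {p : Fin k → ℝ} (hp1 : ∑ i, p i = 1)
    {γ : Fin k → Fin d → ℝ} {δ : Fin d → ℝ} (hγ : IsGoodEstimator b e p γ δ v)
    {g w₀ w s : Fin d → ℝ} (hw : w ∈ b.core d) (hs : s ∈ b.core d)
    {w' : Fin k → Fin d → ℝ} (hw' : ∀ i, w' i = argminOn (b.dom d)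
      (fun x => (g + γ i) ⬝ᵥ x + h x + a * b.breg w₀ x + a' * b.breg w x)) :
    ∃ (s' : Fin k → Fin d → ℝ) (c : Fin k → ℝ), (∀ i, s' i ∈ b.core d) ∧
      (∀ i, w' i ∈ b.core d) ∧ ∑ i, p i * c i ≤ 3 * (e * v) ∧
      ∀ i, ∀ u ∈ b.dom d, (g + h' (w' i)) ⬝ᵥ (w' i - u) + δ ⬝ᵥ (w - u) ≤
        a * (b.breg w₀ u - b.breg w₀ (w' i)) + 1 / e * (b.breg w u - b.breg (w' i) u) +
          2 / e * (b.breg s u - b.breg (s' i) u) + c i := by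
  have he' : 0 < 1 / e := by positivity
  set γ' := ∑ l, p l • γ l with hγ'
  have hx := fun i => mirror_three_point H hd (g + γ i) (a := a) (a' := a') (by rw [ha']; linarith)
    w₀ w (w' i) (hw' i)
  -- The ghost step starts at `s`, uses the noise `γ' - γ i` as gradient, and has step size `e / 2`.
  have hg := fun i => mirror_three_point (isConvexTerm_zero (b := b)) hd (γ' - γ i) (a := 0)
    (a' := 2 / e) (by rw [zero_add]; positivity) s s _ rfl
  set s' := fun i => argminOn (b.dom d) (fun x => (γ' - γ i) ⬝ᵥ x + 0 + 0 * b.breg s x +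
    2 / e * b.breg s x) with hs'
  -- The noise against `w - u` is split at `s` and `s' i`. The part against `w - s` has mean zero,
  -- since neither point depends on the draw; the part against `s - s' i` is the ghost's own step
  -- error; the part against `s' i - u` telescopes. With the step error and the bias this totals `3
  -- * (e * v)`.
  refine ⟨s', fun i => (γ i ⬝ᵥ (w - w' i) - 1 / e * b.breg w (w' i)) + e * v +
    (γ' - γ i) ⬝ᵥ (w - s) + ((γ' - γ i) ⬝ᵥ (s - s' i) - 2 / e * b.breg s (s' i)),
    fun i => (hg i).1, fun i => (hx i).1, ?_, fun i u hu => ?_⟩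
  · have h1 := hγ.step w hw w' fun i => (hx i).1
    have h2 := hγ.ghost s hs s' fun i => (hg i).1
    have h3 : ∑ i, p i * ((γ' - γ i) ⬝ᵥ (w - s)) = 0 := by
      have : ∑ i, p i * (γ i ⬝ᵥ (w - s)) = γ' ⬝ᵥ (w - s) := by
        rw [hγ', sum_dotProduct]
        exact sum_congr rfl fun i _ => by rw [smul_dotProduct, smul_eq_mul]
      simp only [sub_dotProduct γ', mul_sub, sum_sub_distrib]
      rw [this, ← sum_mul, hp1, one_mul, sub_self]
    have h4 : ∑ i, p i * (e * v) = e * v := by rw [← sum_mul, hp1, one_mul]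
    simp only [mul_add, sum_add_distrib]
    rw [h3, h4]
    linarith
  · have h1 := (hx i).2 u hu
    have h2 := (hg i).2 u hu
    have h3 := hγ.bias w hw u hu
    have h4 := mul_nonneg ha (b.breg_nonneg (hx i).1 hu)
    rw [← hγ'] at h3
    change (γ' - γ i + 0) ⬝ᵥ (s' i - u) ≤ 0 * _ + 2 / e * (b.breg s u - b.breg (s' i) u -
      b.breg s (s' i)) at h2
    rw [ha'] at h1
    simp only [add_dotProduct, sub_dotProduct, dotProduct_sub, zero_dotProduct] at h1 h2 h3 ⊢
    linarith

namespace Problem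

variable {n m : ℕ} (P : Problem n m) (S : Setup)

/-- Both blocks of `z` lie in the core. -/
def InCore (z : Pt n m) : Prop := z.1 ∈ S.xBlock.core n ∧ z.2 ∈ S.yBlock.core m

/-- Both blocks of `z` lie in the domain. -/
def InDom (z : Pt n m) : Prop := z.1 ∈ S.xBlock.dom n ∧ z.2 ∈ S.yBlock.dom m

variable {S} in
theorem InCore.inDom {z : Pt n m} (hz : InCore S z) : InDom S z :=
  ⟨S.xBlock.core_subset_dom hz.1, S.yBlock.core_subset_dom hz.2⟩

/-- The rescaled Bregman divergence of the product. -/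
noncomputable def div (ρ : ℝ) (z u : Pt n m) : ℝ :=
  ρ * S.xBlock.breg z.1 u.1 + 1 / ρ * S.yBlock.breg z.2 u.2

variable {S} in
theorem div_nonneg {ρ : ℝ} (hρ : 0 < ρ) {z u : Pt n m} (hz : InCore S z) (hu : InDom S u) :
    0 ≤ div S ρ z u := by
  have h1 := S.xBlock.breg_nonneg hz.1 hu.1
  have h2 := S.yBlock.breg_nonneg hz.2 hu.2
  unfold div
  positivity

theorem div_self (ρ : ℝ) (z : Pt n m) : div S ρ z z = 0 := by
  simp [div, Block.breg_self]

/-- The pairing `⟨g(z), u⟩`. -/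
noncomputable def pair (z u : Pt n m) : ℝ :=
  (P.bilinGrad z).1 ⬝ᵥ u.1 + (P.bilinGrad z).2 ⬝ᵥ u.2

/-- This form makes skew-symmetry visible: `pair z z = 0`. -/
theorem pair_eq (z u : Pt n m) :
    P.pair z u = z.2 ⬝ᵥ P.A.mulVec u.1 - u.2 ⬝ᵥ P.A.mulVec z.1 := by
  have h1 : (P.bilinGrad z).1 = Matrix.vecMul z.2 P.A := by
    ext j
    simp [bilinGrad, Matrix.vecMul, dotProduct, mul_comm]
  have h2 : (P.bilinGrad z).2 = -P.A.mulVec z.1 := by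
    ext i
    simp [bilinGrad, Matrix.mulVec, dotProduct]
  rw [pair, h1, h2, Matrix.dotProduct_mulVec, neg_dotProduct, dotProduct_comm (P.A.mulVec z.1)]
  ring

/-- The linearized regret of `z` against `u`. -/
noncomputable def regret (z u : Pt n m) : ℝ :=
  P.pair z (z - u) + P.gradφ z.1 ⬝ᵥ (z.1 - u.1) + P.gradψ z.2 ⬝ᵥ (z.2 - u.2)

/-- The average of `t` points with sum `σ`. -/
noncomputable def avg (t : ℕ) (σ : Pt n m) : Pt n m := (fun j => σ.1 j / t, fun i => σ.2 i / t)

theorem avg_succ {t : ℕ} (ht : 0 < t) (σ w : Pt n m) :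
    avg (t + 1) (σ + w) = ((t : ℝ) / (t + 1)) • avg t σ + (1 / ((t : ℝ) + 1)) • w := by
  have ht' : (0 : ℝ) < t := by exact_mod_cast ht
  refine Prod.ext (funext fun j => ?_) (funext fun j => ?_) <;>
  · simp only [avg, Prod.fst_add, Prod.snd_add, Prod.smul_fst, Prod.smul_snd, Pi.add_apply,
      Pi.smul_apply, smul_eq_mul]
    push_cast
    field_simp

theorem avg_one (w : Pt n m) : avg 1 w = w := by
  simp [avg]

variable {P S} {μx μy : ℝ}

theorem inCore_avg_succ {t : ℕ} {σ w : Pt n m} (hσ : 0 < t → InCore S (avg t σ))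
    (h0 : t = 0 → σ = 0) (hw : InCore S w) : InCore S (avg (t + 1) (σ + w)) := by
  rcases Nat.eq_zero_or_pos t with rfl | ht
  · rwa [h0 rfl, zero_add, zero_add, avg_one]
  · rw [avg_succ ht]
    have h1 : (0 : ℝ) ≤ t / (t + 1) := by positivity
    have h2 : (0 : ℝ) ≤ 1 / (t + 1) := by positivity
    have h3 : (t : ℝ) / (t + 1) + 1 / (t + 1) = 1 := by field_simp
    exact ⟨S.xBlock.convex_core (hσ ht).1 hw.1 h1 h2 h3,
      S.yBlock.convex_core (hσ ht).2 hw.2 h1 h2 h3⟩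

/-- Jensen's inequality for the running average. By skew-symmetry the bilinear part of the regret is
affine in the point; the composite parts are convex by `regretConvex`. The case `t = 0` is separate
because `avg 0` divides by zero. -/
theorem regret_avg_succ (hφ : IsCompositeTerm S.xBlock P.φ P.gradφ μx)
    (hψ : IsCompositeTerm S.yBlock P.ψ P.gradψ μy) {t : ℕ} {σ w u : Pt n m}
    (hσ : 0 < t → InCore S (avg t σ)) (h0 : t = 0 → σ = 0) (hw : InCore S w) (hu : InDom S u) :
    ((t : ℝ) + 1) * P.regret (avg (t + 1) (σ + w)) u ≤
      t * P.regret (avg t σ) u + P.regret w u := by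
  rcases Nat.eq_zero_or_pos t with rfl | ht
  · rw [h0 rfl, zero_add, zero_add, avg_one]
    simp
  · rw [avg_succ ht]
    have h1 : (0 : ℝ) ≤ t / (t + 1) := by positivity
    have h2 : (0 : ℝ) ≤ 1 / (t + 1) := by positivity
    have h3 : (t : ℝ) / (t + 1) + 1 / (t + 1) = 1 := by field_simp
    have ht1 : (0 : ℝ) < t + 1 := by positivity
    have e1 : ((t : ℝ) + 1) * (t / (t + 1)) = t := by field_simp
    have e2 : ((t : ℝ) + 1) * (1 / (t + 1)) = 1 := by field_simp
    set r : ℝ := t / (t + 1)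
    set s : ℝ := 1 / (t + 1)
    set z := avg t σ
    have hx := (hφ.regretConvex u.1 hu.1).2 (hσ ht).1 hw.1 h1 h2 h3
    have hy := (hψ.regretConvex u.2 hu.2).2 (hσ ht).2 hw.2 h1 h2 h3
    simp only [smul_eq_mul] at hx hy
    have hp : P.pair (r • z + s • w) (r • z + s • w - u) =
        r * P.pair z (z - u) + s * P.pair w (w - u) := by
      simp only [pair_eq, Prod.fst_add, Prod.snd_add, Prod.smul_fst, Prod.smul_snd, Prod.fst_sub,
        Prod.snd_sub, Matrix.mulVec_add, Matrix.mulVec_sub, Matrix.mulVec_smul, dotProduct_add,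
        dotProduct_sub, dotProduct_smul, add_dotProduct, sub_dotProduct, smul_dotProduct,
        smul_eq_mul]
      ring
    have key : P.regret (r • z + s • w) u ≤ r * P.regret z u + s * P.regret w u := by
      simp only [regret, hp]
      simp only [Prod.fst_add, Prod.snd_add, Prod.smul_fst, Prod.smul_snd]
      linarith
    have := mul_le_mul_of_nonneg_left key ht1.le
    rw [mul_add, ← mul_assoc, ← mul_assoc, e1, e2, one_mul] at this
    exact this

theorem abs_pair_le (P : Problem n m) (S : Setup) (z u : Pt n m) :
    |P.pair z u| ≤ S.matConst P.A * (S.yBlock.norm z.2 * S.xBlock.norm u.1 +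
      S.yBlock.norm u.2 * S.xBlock.norm z.1) := by
  rw [pair_eq]
  have h1 := abs_bilin_le P.A S u.1 z.2
  have h2 := abs_bilin_le P.A S z.1 u.2
  have := abs_sub (z.2 ⬝ᵥ P.A.mulVec u.1) (u.2 ⬝ᵥ P.A.mulVec z.1)
  linarith

/-- The boundary term of the inner loop. -/
theorem pair_sub_le {ρ α : ℝ} (hρ : 0 < ρ) (hα : 0 < α) {w₀ w u : Pt n m} (h₀ : InCore S w₀)
    (hw : InDom S w) (hu : InDom S u) :
    P.pair (w - w₀) (w₀ - u) ≤
      α / 4 * div S ρ w₀ w + 16 * S.matConst P.A ^ 2 / α * div S ρ w₀ u := by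
  have h := (le_abs_self _).trans (abs_pair_le P S (w - w₀) (w₀ - u))
  have a1 := S.xBlock.norm_sq_le_breg h₀.1 hw.1
  have b1 := S.yBlock.norm_sq_le_breg h₀.2 hw.2
  have a2 := S.xBlock.norm_sq_le_breg h₀.1 hu.1
  have b2 := S.yBlock.norm_sq_le_breg h₀.2 hu.2
  simp only [Prod.fst_sub, Prod.snd_sub] at h
  rw [S.xBlock.norm_sub_comm w₀.1, S.yBlock.norm_sub_comm w₀.2] at h
  set L := S.matConst P.A
  set a := S.xBlock.norm (w.1 - w₀.1)
  set b := S.yBlock.norm (w.2 - w₀.2)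
  set a' := S.xBlock.norm (u.1 - w₀.1)
  set b' := S.yBlock.norm (u.2 - w₀.2)
  have k1 : L * (b * a') ≤ α / (16 * ρ) * b ^ 2 + 4 * L ^ 2 * ρ / α * a' ^ 2 := by
    have e : α / (16 * ρ) * b ^ 2 + 4 * L ^ 2 * ρ / α * a' ^ 2 - L * (b * a') =
        α / (16 * ρ) * (b - 8 * L * ρ / α * a') ^ 2 := by
      field_simp
      ring
    have : 0 ≤ α / (16 * ρ) * (b - 8 * L * ρ / α * a') ^ 2 := by positivity
    linarith
  have k2 : L * (b' * a) ≤ α * ρ / 16 * a ^ 2 + 4 * L ^ 2 / (α * ρ) * b' ^ 2 := by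
    have e : α * ρ / 16 * a ^ 2 + 4 * L ^ 2 / (α * ρ) * b' ^ 2 - L * (b' * a) =
        α * ρ / 16 * (a - 8 * L / (α * ρ) * b') ^ 2 := by
      field_simp
      ring
    have : 0 ≤ α * ρ / 16 * (a - 8 * L / (α * ρ) * b') ^ 2 := by positivity
    linarith
  have m1 := mul_le_mul_of_nonneg_left a1 (show 0 ≤ α * ρ / 16 by positivity)
  have m2 := mul_le_mul_of_nonneg_left b1 (show 0 ≤ α / (16 * ρ) by positivity)
  have m3 := mul_le_mul_of_nonneg_left a2 (show 0 ≤ 4 * L ^ 2 * ρ / α by positivity)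
  have m4 := mul_le_mul_of_nonneg_left b2 (show 0 ≤ 4 * L ^ 2 / (α * ρ) by positivity)
  refine h.trans ?_
  have e : α / 4 * div S ρ w₀ w + 16 * L ^ 2 / α * div S ρ w₀ u =
      α * ρ / 16 * (4 * S.xBlock.breg w₀.1 w.1) + α / (16 * ρ) * (4 * S.yBlock.breg w₀.2 w.2) +
      4 * L ^ 2 * ρ / α * (4 * S.xBlock.breg w₀.1 u.1) +
      4 * L ^ 2 / (α * ρ) * (4 * S.yBlock.breg w₀.2 u.2) := by
    unfold div
    field_simp
    ring
  rw [e]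
  linarith

/-- The progress of one inner iteration. -/
theorem exists_ghost_innerStep (hφ : IsCompositeTerm S.xBlock P.φ P.gradφ μx)
    (hψ : IsCompositeTerm S.yBlock P.ψ P.gradψ μy) (hμx : 0 ≤ μx) (hμy : 0 ≤ μy) (hn : 0 < n)
    (hm : 0 < m) {q : Params} {ρ : ℝ} (hρ : 0 < ρ) (hα : 0 < q.α)
    (hη0 : 0 < q.η) (hη : q.η * (96 * S.matConst P.A ^ 2) ≤ q.α) {w₀ w s : Pt n m}
    (h₀ : InCore S w₀) (hw : InCore S w) (hs : InCore S s) :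
    ∃ (s' : Fin m → Fin n → Pt n m) (c : Fin m → Fin n → ℝ), (∀ i j, InCore S (s' i j)) ∧
      (∀ i j, InCore S (P.innerX S q ρ w₀ (P.bilinGrad w₀) w i,
        P.innerY S q ρ w₀ (P.bilinGrad w₀) w j)) ∧
      (∑ i, sampleProb S.yBlock (w.2 - w₀.2) i * ∑ j, sampleProb S.xBlock (w.1 - w₀.1) j * c i j
        ≤ q.α / 4 * div S ρ w₀ w) ∧
      ∀ i j, ∀ u, InDom S u → ∀ w' : Pt n m, w' = (P.innerX S q ρ w₀ (P.bilinGrad w₀) w i,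
        P.innerY S q ρ w₀ (P.bilinGrad w₀) w j) →
        P.regret w' u - P.pair (w' - w₀) (w₀ - u) + P.pair (w - w₀) (w₀ - u) ≤
          q.α / 2 * (div S ρ w₀ u - div S ρ w₀ w') + 1 / q.η * (div S ρ w u - div S ρ w' u) +
            2 / q.η * (div S ρ s u - div S ρ (s' i j) u) + c i j := by
  have hx := isGoodEstimator_row P.A S hm (e := q.η / ρ) (by positivity) (w.2 - w₀.2)
  have hy := isGoodEstimator_col P.A S hn (η := q.η) (ρ := ρ) (by positivity) (w.1 - w₀.1)
  obtain ⟨sx, cx, hsx, hwx, hcx, hrx⟩ := stochastic_mirror_step (hφ.isConvexTerm hμx) hn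
    (a := q.α / 2 * ρ) (a' := 1 / q.η * ρ) (by positivity) (by positivity) (by field_simp)
    (sum_sampleProb _ hm) hx (g := (P.bilinGrad w₀).1) (w₀ := w₀.1) hw.1 hs.1
    (w' := P.innerX S q ρ w₀ (P.bilinGrad w₀) w) (fun i => rfl)
  obtain ⟨sy, cy, hsy, hwy, hcy, hry⟩ := stochastic_mirror_step (hψ.isConvexTerm hμy) hm
    (a := q.α / 2 * (1 / ρ)) (a' := 1 / q.η * (1 / ρ)) (by positivity) (by positivity)
    (by field_simp)
    (sum_sampleProb _ hn) hy (g := (P.bilinGrad w₀).2) (w₀ := w₀.2) hw.2 hs.2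
    (w' := P.innerY S q ρ w₀ (P.bilinGrad w₀) w) (fun j => by
      unfold innerY
      congr 1)
  refine ⟨fun i j => (sx i, sy j), fun i j => cx i + cy j, fun i j => ⟨hsx i, hsy j⟩,
    fun i j => ⟨hwx i, hwy j⟩, ?_, ?_⟩
  · have e : ∑ i, sampleProb S.yBlock (w.2 - w₀.2) i *
        ∑ j, sampleProb S.xBlock (w.1 - w₀.1) j * (cx i + cy j) =
        ∑ i, sampleProb S.yBlock (w.2 - w₀.2) i * cx i +
          ∑ j, sampleProb S.xBlock (w.1 - w₀.1) j * cy j := by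
      simp only [mul_add, sum_add_distrib, ← sum_mul, sum_sampleProb _ hm, sum_sampleProb _ hn,
        one_mul]
    rw [e]
    have a1 := S.xBlock.norm_sq_le_breg h₀.1 hw.inDom.1
    have b1 := S.yBlock.norm_sq_le_breg h₀.2 hw.inDom.2
    have hdiv := div_nonneg hρ h₀ hw.inDom
    set L := S.matConst P.A
    -- The noise is `3 * (e * v)` with `v = 2 * L ^ 2 * ‖w - w₀‖ ^ 2` and squared norm at most four
    -- divergences, in total `24 * η * L ^ 2 * div`. Demanding at most `α / 4 * div` gives the `96`.
    have m1 := mul_le_mul_of_nonneg_left b1 (show 0 ≤ 6 * (q.η / ρ) * L ^ 2 by positivity)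
    have m2 := mul_le_mul_of_nonneg_left a1 (show 0 ≤ 6 * (q.η * ρ) * L ^ 2 by positivity)
    have m3 := mul_le_mul_of_nonneg_right hη hdiv
    have e2 : q.η * (96 * L ^ 2) * div S ρ w₀ w =
        4 * (6 * (q.η / ρ) * L ^ 2 * (4 * S.yBlock.breg w₀.2 w.2) +
        6 * (q.η * ρ) * L ^ 2 * (4 * S.xBlock.breg w₀.1 w.1)) := by
      unfold div
      field_simp
      ring
    rw [e2] at m3
    linarith
  · rintro i j u hu w' rfl
    have h1 := hrx i u.1 hu.1
    have h2 := hry j u.2 hu.2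
    set x := P.innerX S q ρ w₀ (P.bilinGrad w₀) w i
    set y := P.innerY S q ρ w₀ (P.bilinGrad w₀) w j
    have e1 : P.regret (x, y) u - P.pair ((x, y) - w₀) (w₀ - u) + P.pair (w - w₀) (w₀ - u) =
        ((P.bilinGrad w₀).1 + P.gradφ x) ⬝ᵥ (x - u.1) +
          (fun j => ∑ i, P.A i j * (w.2 - w₀.2) i) ⬝ᵥ (w.1 - u.1) +
        (((P.bilinGrad w₀).2 + P.gradψ y) ⬝ᵥ (y - u.2) +
          (fun i => -∑ j, P.A i j * (w.1 - w₀.1) j) ⬝ᵥ (w.2 - u.2)) := by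
      have e3 : (fun j => ∑ i, P.A i j * (w.2 - w₀.2) i) ⬝ᵥ (w.1 - u.1) +
          (fun i => -∑ j, P.A i j * (w.1 - w₀.1) j) ⬝ᵥ (w.2 - u.2) =
          P.pair (w - w₀) (w - u) := rfl
      have e4 : (P.bilinGrad w₀).1 ⬝ᵥ (x - u.1) + (P.bilinGrad w₀).2 ⬝ᵥ (y - u.2) =
          P.pair w₀ ((x, y) - u) := rfl
      -- Since `pair (w - w₀) (w - w₀) = 0`, the gradient at the old and at the new point differ
      -- only through the telescoping terms `pair (· - w₀) (w₀ - u)`.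
      have e5 : P.pair (x, y) ((x, y) - u) - P.pair ((x, y) - w₀) (w₀ - u) +
          P.pair (w - w₀) (w₀ - u) = P.pair w₀ ((x, y) - u) + P.pair (w - w₀) (w - u) := by
        simp only [pair_eq, Prod.fst_sub, Prod.snd_sub, Matrix.mulVec_sub, dotProduct_sub,
          sub_dotProduct]
        ring
      rw [regret, add_dotProduct, add_dotProduct]
      linarith
    rw [e1]
    refine (add_le_add h1 h2).trans (le_of_eq ?_)
    unfold div
    field_simp
    ring

/-- The averaged inner iterates form a relaxed proximal point in expectation. -/
theorem mean_inner_le (hφ : IsCompositeTerm S.xBlock P.φ P.gradφ μx)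
    (hψ : IsCompositeTerm S.yBlock P.ψ P.gradψ μy) (hμx : 0 ≤ μx) (hμy : 0 ≤ μy) (hn : 0 < n)
    (hm : 0 < m) {q : Params} {ρ : ℝ} (hρ : 0 < ρ) (hα : 0 < q.α)
    (hη0 : 0 < q.η) (hη : q.η * (96 * S.matConst P.A ^ 2) = q.α) (hT0 : 1 ≤ q.T)
    (hT : 608 * S.matConst P.A ^ 2 ≤ q.T * q.α ^ 2) {w₀ : Pt n m} (h₀ : InCore S w₀)
    {F : Pt n m × Pt n m → ℝ}
    (hF : ∀ s, InCore S (avg q.T s.2) → ∃ u, InDom S u ∧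
      F s ≤ q.T * (P.regret (avg q.T s.2) u - q.α * div S ρ w₀ u)) :
    (Comp.iterate (P.innerStep S q ρ w₀ (P.bilinGrad w₀)) q.T (w₀, (0, 0))).mean F ≤ 0 := by
  -- Induction on the number `k` of remaining steps, `t` being done. The ghost point `s` and the
  -- accumulated error `c` belong to the proof and not to the program. The invariant holds for every
  -- `u` simultaneously, so `u` can be chosen after all draws.
  have main : ∀ (k t : ℕ) (w σ s : Pt n m) (c : ℝ), t + k = q.T → InCore S w → InCore S s →
      (0 < t → InCore S (avg t σ)) → (t = 0 → σ = 0) →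
      (∀ u, InDom S u → t * P.regret (avg t σ) u - P.pair (w - w₀) (w₀ - u) ≤
        t * (q.α / 2 * div S ρ w₀ u) + 1 / q.η * (div S ρ w₀ u - div S ρ w u) +
          2 / q.η * (div S ρ w₀ u - div S ρ s u) + c) →
      (Comp.iterate (P.innerStep S q ρ w₀ (P.bilinGrad w₀)) k (w, σ)).mean F ≤
        c + q.α / 4 * div S ρ w₀ w := by
    intro k
    induction k with
    | zero =>
      intro t w σ s c ht hw hs hσ _ hinv
      obtain rfl : t = q.T := by omega
      obtain ⟨u, hu, hFu⟩ := hF (w, σ) (hσ (by omega))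
      have h1 := hinv u hu
      have h2 := pair_sub_le (P := P) hρ hα h₀ hw.inDom hu
      have h3 := mul_nonneg (show 0 ≤ 1 / q.η by positivity) (div_nonneg hρ hw hu)
      have h4 := mul_nonneg (show 0 ≤ 2 / q.η by positivity) (div_nonneg hρ hs hu)
      have h5 := div_nonneg hρ h₀ hu
      set D := div S ρ w₀ u
      -- With `1 / η = 96 * L ^ 2 / α`, the boundary term, the iterates and the ghost cost `16 + 96
      -- + 192 = 304` times `L ^ 2 / α * D`, against the remaining budget `T * α / 2 * D`; hence
      -- `608`.
      have h6 : 16 * S.matConst P.A ^ 2 / q.α * D + 1 / q.η * D + 2 / q.η * D ≤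
          q.T * (q.α / 2 * D) := by
        have e1 : 1 / q.η = 96 * S.matConst P.A ^ 2 / q.α := by
          rw [div_eq_div_iff hη0.ne' hα.ne', one_mul, mul_comm, hη]
        have e2 : 2 / q.η = 2 * (1 / q.η) := by ring
        rw [e2, e1]
        have e3 : 16 * S.matConst P.A ^ 2 / q.α * D + 96 * S.matConst P.A ^ 2 / q.α * D +
            2 * (96 * S.matConst P.A ^ 2 / q.α) * D =
            608 * S.matConst P.A ^ 2 * (D / (2 * q.α)) := by
          field_simp
          ring
        have e4 : q.T * (q.α / 2 * D) = q.T * q.α ^ 2 * (D / (2 * q.α)) := by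
          field_simp
        rw [e3, e4]
        exact mul_le_mul_of_nonneg_right hT (by positivity)
      change F (w, σ) ≤ _
      refine hFu.trans ?_
      change (q.T : ℝ) * (P.regret (avg q.T σ) u - q.α * D) ≤ _
      linarith
    | succ k ih =>
      intro t w σ s c ht hw hs hσ h0 hinv
      obtain ⟨s', c', hs', hw', hc', hstep⟩ := exists_ghost_innerStep hφ hψ hμx hμy hn hm hρ hα hη0
        hη.le h₀ hw hs
      change (Comp.bind _ _).mean F ≤ _
      rw [Comp.mean_bind, mean_innerStep]
      set W : Fin m → Fin n → Pt n m := fun i j => (P.innerX S q ρ w₀ (P.bilinGrad w₀) w i,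
        P.innerY S q ρ w₀ (P.bilinGrad w₀) w j) with hW
      have hnext : ∀ i j, (Comp.iterate (P.innerStep S q ρ w₀ (P.bilinGrad w₀)) k
          (W i j, σ + W i j)).mean F ≤ c + c' i j := fun i j => by
        have hD := mul_nonneg hα.le (div_nonneg hρ h₀ (hw' i j).inDom)
        -- Of the gain `α / 2 * div w₀ w'`, one half pays for the noise of the next step, or for the
        -- boundary term after the last one; the other half is dropped.
        refine (ih (t + 1) (W i j) (σ + W i j) (s' i j)
          (c + c' i j - q.α / 2 * div S ρ w₀ (W i j)) (by omega) (hw' i j) (hs' i j)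
          (fun _ => inCore_avg_succ hσ h0 (hw' i j)) (by omega) fun u hu => ?_).trans ?_
        · have r1 := hstep i j u hu (W i j) rfl
          have r2 := regret_avg_succ hφ hψ hσ h0 (hw' i j) hu
          have r3 := hinv u hu
          push_cast
          change _ * P.regret (avg (t + 1) (σ + W i j)) u ≤ _ + P.regret (W i j) u at r2
          linarith
        · change 0 ≤ q.α * div S ρ w₀ (W i j) at hD
          linarith
      have hsum : ∑ i, sampleProb S.yBlock (w.2 - w₀.2) i *
          ∑ j, sampleProb S.xBlock (w.1 - w₀.1) j * (c + c' i j) =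
          c + ∑ i, sampleProb S.yBlock (w.2 - w₀.2) i *
          ∑ j, sampleProb S.xBlock (w.1 - w₀.1) j * c' i j := by
        simp only [mul_add, sum_add_distrib, ← sum_mul, sum_sampleProb _ hm, sum_sampleProb _ hn,
          one_mul]
      refine le_trans ?_ (hsum.trans_le (by linarith))
      exact sum_le_sum fun i _ => mul_le_mul_of_nonneg_left (sum_le_sum fun j _ =>
        mul_le_mul_of_nonneg_left (hnext i j) (sampleProb_nonneg _ j)) (sampleProb_nonneg _ i)
  have := main q.T 0 w₀ 0 w₀ 0 (by omega) h₀ h₀ (by omega) (fun _ => rfl) fun u _ => by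
    simp [pair_eq]
  rw [div_self, mul_zero, add_zero] at this
  exact this

end Problem

theorem Comp.always_of_forall {α : Type} {Q : α → Prop} (h : ∀ a, Q a) (p : Comp α) :
    p.Always Q := by
  induction p with
  | ret a => exact h a
  | spend c p ih => exact ih
  | draw w next ih => exact ih

/-- Relative strong convexity in gradient form. -/
theorem IsCompositeTerm.gradient_le {b : Block} {d : ℕ} {h : (Fin d → ℝ) → ℝ}
    {h' : (Fin d → ℝ) → Fin d → ℝ} {μ : ℝ} (H : IsCompositeTerm b h h' μ) {x u : Fin d → ℝ}
    (hx : x ∈ b.core d) (hu : u ∈ b.dom d) :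
    h x - h u + μ * b.breg x u ≤ h' x ⬝ᵥ (x - u) := by
  have := le_sub_of_convexOn H.stronglyConvex (b.core_subset_dom hx) hu
    ((H.isGrad x hx u hu).sub ((b.hasDerivWithinAt_dgf hx u).const_mul μ))
  rw [← neg_sub u x, dotProduct_neg, Block.breg]
  linarith

namespace Problem

variable {n m : ℕ} {P : Problem n m} {S : Setup} {μx μy : ℝ}

/-! ## Saddle points and the gap -/

/-- Sion's minimax theorem on compact convex domains. The saddle point serves only as a reference
point of the analysis. -/
theorem exists_saddle (hφ : IsConvexTerm S.xBlock P.φ P.gradφ)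
    (hψ : IsConvexTerm S.yBlock P.ψ P.gradψ) (hn : 0 < n) (hm : 0 < m) :
    ∃ z : Pt n m, InDom S z ∧
      IsSaddlePointOn (S.xBlock.dom n) (S.yBlock.dom m) P.obj z.1 z.2 := by
  have e : ∀ x y, y ⬝ᵥ P.A.mulVec x = Matrix.vecMul y P.A ⬝ᵥ x := fun x y =>
    Matrix.dotProduct_mulVec _ _ _
  suffices h : ∃ x ∈ S.xBlock.dom n, ∃ y ∈ S.yBlock.dom m,
      IsSaddlePointOn (S.xBlock.dom n) (S.yBlock.dom m) P.obj x y by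
    obtain ⟨x, hx, y, hy, h⟩ := h
    exact ⟨(x, y), ⟨hx, hy⟩, h⟩
  refine Sion.exists_isSaddlePointOn (f := P.obj)
    ((S.xBlock.core_nonempty hn).mono S.xBlock.core_subset_dom) S.xBlock.convex_dom
    S.xBlock.isCompact_dom (fun y _ => ?_) (fun y _ => ?_) S.yBlock.convex_dom
    ((S.yBlock.core_nonempty hm).mono S.yBlock.core_subset_dom) S.yBlock.isCompact_dom
    (fun x _ => ?_) (fun x _ => ?_)
  · refine ContinuousOn.lowerSemicontinuousOn ?_
    simp only [obj, e]
    exact ((continuous_dotProduct_left _).continuousOn.add hφ.continuousOn).sub continuousOn_const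
  · refine ConvexOn.quasiconvexOn ?_
    simp only [obj, e]
    exact ((dotProduct_convexOn _ S.xBlock.convex_dom).add hφ.convexOn).sub
      (concaveOn_const _ S.xBlock.convex_dom)
  · refine ContinuousOn.upperSemicontinuousOn ?_
    simp only [obj, dotProduct_comm _ (P.A.mulVec x)]
    exact ((continuous_dotProduct_left _).continuousOn.add continuousOn_const).sub hψ.continuousOn
  · refine ConcaveOn.quasiconcaveOn ?_
    have := (((dotProduct_convexOn (-P.A.mulVec x) S.yBlock.convex_dom).add
      (convexOn_const (-P.φ x) S.yBlock.convex_dom)).add hψ.convexOn).neg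
    refine this.congr fun y _ => ?_
    simp only [obj, dotProduct_comm _ (P.A.mulVec x), Pi.neg_apply, Pi.add_apply, neg_dotProduct]
    ring

theorem gap_le_norm {B : ℝ} (hB : P.LinearGrowth S B) {zs : Pt n m} (hzs : InDom S zs)
    (hsad : IsSaddlePointOn (S.xBlock.dom n) (S.yBlock.dom m) P.obj zs.1 zs.2) {z : Pt n m}
    (hz : InDom S z) :
    P.gap S z ≤ (B + 2 * S.matConst P.A) *
      √(S.xBlock.norm (z.1 - zs.1) ^ 2 + S.yBlock.norm (z.2 - zs.2) ^ 2) := by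
  have hg := hB zs.1 hzs.1 zs.2 hzs.2 hsad z.1 hz.1 z.2 hz.2
  have hL := matConst_nonneg P.A S
  set L := S.matConst P.A
  set a := S.xBlock.norm (z.1 - zs.1) with ha
  set b := S.yBlock.norm (z.2 - zs.2) with hb
  have ha0 : 0 ≤ a := S.xBlock.norm_nonneg _
  have hb0 : 0 ≤ b := S.yBlock.norm_nonneg _
  have ha1 : a ≤ √(a ^ 2 + b ^ 2) := Real.le_sqrt_of_sq_le (by nlinarith)
  have hb1 : b ≤ √(a ^ 2 + b ^ 2) := Real.le_sqrt_of_sq_le (by nlinarith)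
  have hsup : sSup ((fun y => P.obj z.1 y) '' S.yBlock.dom m) ≤
      P.obj zs.1 zs.2 + L * a + (P.φ z.1 - P.φ zs.1) := by
    refine csSup_le (Set.Nonempty.image _ ⟨_, hzs.2⟩) ?_
    rintro _ ⟨y, hy, rfl⟩
    have h1 := hsad zs.1 hzs.1 y hy
    have h2 := (le_abs_self _).trans (abs_bilin_le P.A S (z.1 - zs.1) y)
    have h3 : L * S.yBlock.norm y * a ≤ L * a := by
      have := mul_le_mul_of_nonneg_left (S.yBlock.norm_le_one hy) (mul_nonneg hL ha0)
      linarith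
    rw [Matrix.mulVec_sub, dotProduct_sub] at h2
    simp only [obj] at h1 ⊢
    linarith
  have hinf : P.obj zs.1 zs.2 - L * b - (P.ψ z.2 - P.ψ zs.2) ≤
      sInf ((fun x => P.obj x z.2) '' S.xBlock.dom n) := by
    refine le_csInf (Set.Nonempty.image _ ⟨_, hzs.1⟩) ?_
    rintro _ ⟨x, hx, rfl⟩
    have h1 := hsad x hx zs.2 hzs.2
    have h2 := (neg_abs_le _).trans' (neg_le_neg (abs_bilin_le P.A S x (z.2 - zs.2)))
    have h3 : L * b * S.xBlock.norm x ≤ L * b := by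
      have := mul_le_mul_of_nonneg_left (S.xBlock.norm_le_one hx) (mul_nonneg hL hb0)
      linarith
    rw [sub_dotProduct] at h2
    simp only [obj] at h1 ⊢
    linarith
  have h4 := mul_le_mul_of_nonneg_left ha1 hL
  have h5 := mul_le_mul_of_nonneg_left hb1 hL
  unfold gap
  linarith

theorem norm_sq_le_div {ρ : ℝ} (hρ : 0 < ρ) {z u : Pt n m} (hz : InCore S z) (hu : InDom S u) :
    S.xBlock.norm (z.1 - u.1) ^ 2 + S.yBlock.norm (z.2 - u.2) ^ 2 ≤
      4 * (ρ + 1 / ρ) * div S ρ z u := by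
  have h1 := S.xBlock.norm_sq_le_breg hz.1 hu.1
  have h2 := S.yBlock.norm_sq_le_breg hz.2 hu.2
  rw [S.xBlock.norm_sub_comm, S.yBlock.norm_sub_comm]
  have h3 := S.xBlock.breg_nonneg hz.1 hu.1
  have h4 := S.yBlock.breg_nonneg hz.2 hu.2
  have e : 4 * (ρ + 1 / ρ) * div S ρ z u = 4 * S.xBlock.breg z.1 u.1 + 4 * S.yBlock.breg z.2 u.2 +
      4 * (ρ ^ 2 * S.xBlock.breg z.1 u.1 + 1 / ρ ^ 2 * S.yBlock.breg z.2 u.2) := by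
    unfold div
    field_simp
    ring
  have : 0 ≤ 4 * (ρ ^ 2 * S.xBlock.breg z.1 u.1 + 1 / ρ ^ 2 * S.yBlock.breg z.2 u.2) := by
    positivity
  linarith

/-- The gap is of the order of the square root of `div`. Young's inequality with offset `ε / 2`
makes the bound affine in `div`, so that it passes directly through the expectation. -/
theorem gap_le_div {B : ℝ} (hB0 : 0 < B) (hB : P.LinearGrowth S B) {zs : Pt n m}
    (hzs : InDom S zs)
    (hsad : IsSaddlePointOn (S.xBlock.dom n) (S.yBlock.dom m) P.obj zs.1 zs.2) {ρ : ℝ}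
    (hρ : 0 < ρ) {ε : ℝ} (hε : 0 < ε) {z : Pt n m} (hz : InCore S z) :
    P.gap S z ≤
      8 * (B + S.matConst P.A) ^ 2 * (ρ + 1 / ρ) / ε * div S ρ z zs + ε / 2 := by
  have h1 := gap_le_norm hB hzs hsad hz.inDom
  have h2 := norm_sq_le_div hρ hz hzs
  have hL := matConst_nonneg P.A S
  set L := S.matConst P.A
  set Y := S.xBlock.norm (z.1 - zs.1) ^ 2 + S.yBlock.norm (z.2 - zs.2) ^ 2
  have hY : 0 ≤ Y := by positivity
  have hsq := Real.sq_sqrt hY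
  have hs0 := Real.sqrt_nonneg Y
  set G := 2 * (B + L)
  have hG : 0 < G := by positivity
  have h3 : (B + 2 * L) * √Y ≤ G * √Y := mul_le_mul_of_nonneg_right (by linarith) hs0
  have h4 : G * √Y ≤ G ^ 2 / (2 * ε) * Y + ε / 2 := by
    have e : G ^ 2 / (2 * ε) * Y + ε / 2 - G * √Y = (G * √Y - ε) ^ 2 / (2 * ε) := by
      nth_rw 1 [← hsq]
      field_simp
      ring
    have : 0 ≤ (G * √Y - ε) ^ 2 / (2 * ε) := by positivity
    linarith
  have h5 := mul_le_mul_of_nonneg_left h2 (show 0 ≤ G ^ 2 / (2 * ε) by positivity)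
  have e : G ^ 2 / (2 * ε) * (4 * (ρ + 1 / ρ) * div S ρ z zs) =
      8 * (B + L) ^ 2 * (ρ + 1 / ρ) / ε * div S ρ z zs := by
    simp only [G]
    field_simp
    ring
  linarith

/-! ## The outer loop -/

/-- The positive multiple of `r` in the step forces an interior minimizer, wherever `z` and `v` lie.
-/
theorem inCore_outerPoint (hn : 0 < n) (hm : 0 < m) {q : Params} {μ ρ : ℝ} (hρ : 0 < ρ)
    (hα : 0 < q.α) (hμ : 0 < μ) (z v : Pt n m) : InCore S (P.outerPoint S q μ ρ z v) :=
  ⟨(mirror_three_point isConvexTerm_zero hn _ (by positivity) _ _ _ rfl).1,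
    (mirror_three_point isConvexTerm_zero hm _ (by positivity) _ _ _ rfl).1⟩

theorem always_outerStep (hn : 0 < n) (hm : 0 < m) {q : Params} {μ ρ : ℝ} (hρ : 0 < ρ)
    (hα : 0 < q.α) (hμ : 0 < μ) (z : Pt n m) : (P.outerStep S q μ ρ z).Always (InCore S) :=
  Comp.always_bind (Comp.always_of_forall (Q := fun _ => True) (fun _ => trivial) _) fun _ _ =>
    ⟨(mirror_three_point isConvexTerm_zero hn _
        (show 0 < q.α * ρ + μ * ρ by positivity) _ _ _ rfl).1,
      (mirror_three_point isConvexTerm_zero hm _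
        (show 0 < q.α * (1 / ρ) + μ * (1 / ρ) by positivity) _ _ _ rfl).1⟩

theorem div_outerPoint_le (hφ : IsCompositeTerm S.xBlock P.φ P.gradφ μx)
    (hψ : IsCompositeTerm S.yBlock P.ψ P.gradψ μy) (hn : 0 < n)
    (hm : 0 < m) {q : Params} {μ ρ : ℝ} (hρ : 0 < ρ) (hα : 0 < q.α) (hμ : 0 < μ)
    (hμρ : μ * ρ = μx) (hμρ' : μ * (1 / ρ) = μy) {zs : Pt n m} (hzs : InDom S zs)
    (hsad : IsSaddlePointOn (S.xBlock.dom n) (S.yBlock.dom m) P.obj zs.1 zs.2) {z v : Pt n m}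
    (hv : InCore S v) :
    (q.α + μ) * div S ρ (P.outerPoint S q μ ρ z v) zs - q.α * div S ρ z zs ≤
      P.regret v (P.outerPoint S q μ ρ z v) -
        q.α * div S ρ z (P.outerPoint S q μ ρ z v) := by
  obtain ⟨hx, h1⟩ := mirror_three_point (isConvexTerm_zero (b := S.xBlock)) hn
    (fun j => (P.bilinGrad v).1 j + P.gradφ v.1 j) (a := q.α * ρ) (a' := μ * ρ) (by positivity)
    z.1 v.1 _ rfl
  obtain ⟨hy, h2⟩ := mirror_three_point (isConvexTerm_zero (b := S.yBlock)) hm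
    (fun i => (P.bilinGrad v).2 i + P.gradψ v.2 i) (a := q.α * (1 / ρ)) (a' := μ * (1 / ρ))
    (by positivity) z.2 v.2 _ rfl
  have h1 := h1 zs.1 hzs.1
  have h2 := h2 zs.2 hzs.2
  have gx := hφ.gradient_le hv.1 hzs.1
  have gy := hψ.gradient_le hv.2 hzs.2
  have hs := hsad v.1 hv.inDom.1 v.2 hv.inDom.2
  set z' := P.outerPoint S q μ ρ z v with hz'
  change ((P.bilinGrad v).1 + P.gradφ v.1 + 0) ⬝ᵥ (z'.1 - zs.1) ≤
    q.α * ρ * (S.xBlock.breg z.1 zs.1 - S.xBlock.breg z'.1 zs.1 - S.xBlock.breg z.1 z'.1) +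
    μ * ρ * (S.xBlock.breg v.1 zs.1 - S.xBlock.breg z'.1 zs.1 - S.xBlock.breg v.1 z'.1) at h1
  change ((P.bilinGrad v).2 + P.gradψ v.2 + 0) ⬝ᵥ (z'.2 - zs.2) ≤
    q.α * (1 / ρ) *
      (S.yBlock.breg z.2 zs.2 - S.yBlock.breg z'.2 zs.2 - S.yBlock.breg z.2 z'.2) +
    μ * (1 / ρ) *
      (S.yBlock.breg v.2 zs.2 - S.yBlock.breg z'.2 zs.2 - S.yBlock.breg v.2 z'.2) at h2
  -- The three-point inequality leaves `μ * div v zs` on the right. Strong convexity and the saddle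
  -- inequality give `regret v zs ≥ μ * div v zs`, which cancels it; `μ * div v z'` is discarded.
  have k1 := mul_nonneg (show 0 ≤ μ * ρ by positivity)
    (S.xBlock.breg_nonneg hv.1 (S.xBlock.core_subset_dom hx))
  have k2 := mul_nonneg (show 0 ≤ μ * (1 / ρ) by positivity)
    (S.yBlock.breg_nonneg hv.2 (S.yBlock.core_subset_dom hy))
  change 0 ≤ μ * ρ * S.xBlock.breg v.1 z'.1 at k1
  change 0 ≤ μ * (1 / ρ) * S.yBlock.breg v.2 z'.2 at k2
  rw [← hμρ] at gx
  rw [← hμρ'] at gy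
  have e1 : P.pair v (v - z') + ((P.bilinGrad v).1 ⬝ᵥ (z'.1 - zs.1) +
      (P.bilinGrad v).2 ⬝ᵥ (z'.2 - zs.2)) =
      zs.2 ⬝ᵥ P.A.mulVec v.1 - v.2 ⬝ᵥ P.A.mulVec zs.1 := by
    change _ + P.pair v (z' - zs) = _
    simp only [pair_eq, Prod.fst_sub, Prod.snd_sub, Matrix.mulVec_sub, dotProduct_sub,
      sub_dotProduct]
    ring
  simp only [obj] at hs
  simp only [regret, div, add_dotProduct, zero_dotProduct, dotProduct_sub] at h1 h2 gx gy e1 ⊢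
  linarith

theorem mean_outerStep_le (hφ : IsCompositeTerm S.xBlock P.φ P.gradφ μx)
    (hψ : IsCompositeTerm S.yBlock P.ψ P.gradψ μy) (hμx : 0 ≤ μx) (hμy : 0 ≤ μy) (hn : 0 < n)
    (hm : 0 < m) {q : Params} {μ ρ : ℝ} (hρ : 0 < ρ) (hα : 0 < q.α) (hμ : 0 < μ)
    (hμρ : μ * ρ = μx) (hμρ' : μ * (1 / ρ) = μy)
    (hη0 : 0 < q.η) (hη : q.η * (96 * S.matConst P.A ^ 2) = q.α) (hT0 : 1 ≤ q.T)
    (hT : 608 * S.matConst P.A ^ 2 ≤ q.T * q.α ^ 2) {zs : Pt n m} (hzs : InDom S zs)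
    (hsad : IsSaddlePointOn (S.xBlock.dom n) (S.yBlock.dom m) P.obj zs.1 zs.2) {z : Pt n m}
    (hz : InCore S z) {a : ℝ} (ha : 0 ≤ a) (b : ℝ) :
    (P.outerStep S q μ ρ z).mean (fun z' => a * div S ρ z' zs + b) ≤
      a * (q.α / (q.α + μ)) * div S ρ z zs + b := by
  have hT' : (0 : ℝ) < q.T := by exact_mod_cast hT0
  rw [mean_outerStep]
  -- The comparator is the next outer point, itself a function of the random average.
  have h := mean_inner_le hφ hψ hμx hμy hn hm hρ hα hη0 hη hT0 hT hz
    (F := fun s => q.T * ((q.α + μ) * div S ρ (P.outerPoint S q μ ρ z (avg q.T s.2)) zs -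
      q.α * div S ρ z zs)) fun s hs =>
      ⟨_, (inCore_outerPoint hn hm hρ hα hμ z (avg q.T s.2)).inDom,
        mul_le_mul_of_nonneg_left (div_outerPoint_le hφ hψ hn hm hρ hα hμ hμρ hμρ' hzs hsad hs)
          hT'.le⟩
  have e : (fun s : Pt n m × Pt n m => a * div S ρ (P.outerPoint S q μ ρ z
      (fun j => s.2.1 j / q.T, fun i => s.2.2 i / q.T)) zs + b) = fun s =>
      a / (q.T * (q.α + μ)) *
        (q.T * ((q.α + μ) * div S ρ (P.outerPoint S q μ ρ z (avg q.T s.2)) zs -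
          q.α * div S ρ z zs)) + (a * (q.α / (q.α + μ)) * div S ρ z zs + b) := by
    funext s
    change a * div S ρ (P.outerPoint S q μ ρ z (avg q.T s.2)) zs + b = _
    field_simp
    ring
  rw [e, Comp.mean_mul_add (Comp.proper_iterate (P.proper_innerStep S q ρ _ _ hn hm) _ _)]
  have := mul_nonpos_of_nonneg_of_nonpos (show 0 ≤ a / (q.T * (q.α + μ)) by positivity) h
  linarith

theorem mean_iterate_outerStep_le (hφ : IsCompositeTerm S.xBlock P.φ P.gradφ μx)
    (hψ : IsCompositeTerm S.yBlock P.ψ P.gradψ μy) (hμx : 0 ≤ μx) (hμy : 0 ≤ μy) (hn : 0 < n)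
    (hm : 0 < m) {q : Params} {μ ρ : ℝ} (hρ : 0 < ρ) (hα : 0 < q.α) (hμ : 0 < μ)
    (hμρ : μ * ρ = μx) (hμρ' : μ * (1 / ρ) = μy)
    (hη0 : 0 < q.η) (hη : q.η * (96 * S.matConst P.A ^ 2) = q.α) (hT0 : 1 ≤ q.T)
    (hT : 608 * S.matConst P.A ^ 2 ≤ q.T * q.α ^ 2) {zs : Pt n m} (hzs : InDom S zs)
    (hsad : IsSaddlePointOn (S.xBlock.dom n) (S.yBlock.dom m) P.obj zs.1 zs.2)
    {a : ℝ} (ha : 0 ≤ a) (b : ℝ) {f : Pt n m → ℝ}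
    (hf : ∀ z, InCore S z → f z ≤ a * div S ρ z zs + b) (k : ℕ) {z : Pt n m} (hz : InCore S z) :
    (Comp.iterate (P.outerStep S q μ ρ) k z).mean f ≤
      a * (q.α / (q.α + μ)) ^ k * div S ρ z zs + b := by
  induction k generalizing z with
  | zero =>
    rw [pow_zero, mul_one]
    exact hf z hz
  | succ k ih =>
    change (Comp.bind _ _).mean f ≤ _
    rw [Comp.mean_bind]
    refine (Comp.mean_mono (P.proper_outerStep S q ρ hn hm μ z)
      (always_outerStep hn hm hρ hα hμ z) fun z' hz' => ih hz').trans ?_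
    refine (mean_outerStep_le hφ hψ hμx hμy hn hm hρ hα hμ hμρ hμρ' hη0 hη hT0 hT hzs hsad hz
      (by positivity) b).trans_eq ?_
    rw [pow_succ]
    ring

theorem rangeConst_add_le (S : Setup) (hn : 0 < n) (hm : 0 < m) :
    S.xBlock.rangeConst n + S.yBlock.rangeConst m ≤ S.range n m := by
  have hn' : (0 : ℝ) < n := by exact_mod_cast hn
  have hm' : (0 : ℝ) < m := by exact_mod_cast hm
  cases S
  · simp only [Setup.xBlock, Setup.yBlock, Block.rangeConst, Setup.range]
    rw [Real.log_mul hm'.ne' hn'.ne', add_comm]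
  · simp only [Setup.xBlock, Setup.yBlock, Block.rangeConst, Setup.range]
    rw [Real.log_mul two_ne_zero hm'.ne']
    linarith [Real.log_two_gt_d9]
  · simp only [Setup.xBlock, Setup.yBlock, Block.rangeConst, Setup.range]
    norm_num

theorem rangeConst_nonneg (b : Block) (d : ℕ) : 0 ≤ b.rangeConst d := by
  cases b
  · exact Real.log_natCast_nonneg d
  · simp [Block.rangeConst]

/-- The starting point. -/
noncomputable def start (S : Setup) : Pt n m :=
  (argminOn (S.xBlock.dom n) S.xBlock.dgf, argminOn (S.yBlock.dom m) S.yBlock.dgf)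

theorem inCore_start (hn : 0 < n) (hm : 0 < m) : InCore S (start S : Pt n m) :=
  ⟨(argminOn_dgf_spec _ hn).1, (argminOn_dgf_spec _ hm).1⟩

theorem div_start_le (hn : 0 < n) (hm : 0 < m) {ρ : ℝ} (hρ : 0 < ρ) {u : Pt n m}
    (hu : InDom S u) : div S ρ (start S) u ≤ (ρ + 1 / ρ) * S.range n m := by
  have h1 := (argminOn_dgf_spec S.xBlock hn).2 u.1 hu.1
  have h2 := (argminOn_dgf_spec S.yBlock hm).2 u.2 hu.2
  have h3 := rangeConst_add_le S hn hm
  have h4 := rangeConst_nonneg S.xBlock n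
  have h5 := rangeConst_nonneg S.yBlock m
  have hρ' : 0 < 1 / ρ := by positivity
  calc div S ρ (start S) u ≤ ρ * S.xBlock.rangeConst n + 1 / ρ * S.yBlock.rangeConst m :=
        add_le_add (mul_le_mul_of_nonneg_left h1 hρ.le) (mul_le_mul_of_nonneg_left h2 hρ'.le)
    _ ≤ (ρ + 1 / ρ) * (S.xBlock.rangeConst n + S.yBlock.rangeConst m) := by
        nlinarith [mul_nonneg hρ.le h5, mul_nonneg hρ'.le h4]
    _ ≤ _ := mul_le_mul_of_nonneg_left h3 (by positivity)

end Problem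

/-! ## Choice of the parameters -/

/-- The parameters of the algorithm. -/
noncomputable def chosenParams (S : Setup) (n m N : ℕ) (L μx μy B ε : ℝ) : Params where
  -- `η` is the step size at which the noise condition holds with equality; `T` is the least integer
  -- with `T * α ^ 2 ≥ 608 * L ^ 2`.
  α := L * √((m + n) / N)
  η := L * √((m + n) / N) / (96 * L ^ 2)
  T := ⌈608 * (N : ℝ) / (m + n)⌉₊
  K := ⌈6 * logFactor L B (S.range n m) μx μy ε /
    Real.log (1 + N / condTerm n m N L μx μy)⌉₊

theorem matConst_pos {n m : ℕ} {A : Matrix (Fin m) (Fin n) ℝ} (S : Setup) (hA : 0 < nnz A) :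
    0 < S.matConst A := by
  obtain ⟨⟨i, j⟩, hij⟩ := (Set.ncard_pos (Set.toFinite _)).1 hA
  exact (abs_pos.2 hij).trans_le (abs_entry_le_matConst A S i j)

section

variable {n m N : ℕ} {L μx μy : ℝ}

theorem condTerm_eq (hN : 0 < N) :
    condTerm n m N L μx μy = N * (L * √((m + n) / N)) / √(μx * μy) := by
  have hN' : (0 : ℝ) < N := by exact_mod_cast hN
  have e : √((N : ℝ) * (m + n)) = N * √((m + n) / N) := by
    have : (N : ℝ) * (m + n) = (N : ℝ) ^ 2 * ((m + n) / N) := by field_simp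
    rw [this, Real.sqrt_mul (by positivity), Real.sqrt_sq hN'.le]
  rw [condTerm, e]
  ring

/-- The running time bound for the chosen numbers of iterations. -/
theorem time_bound {t Λ ℓ : ℝ} (hm : 0 < m) (hmn : m + n ≤ 2 * N) (hΛ : 0 < Λ) (hℓ : 0 ≤ ℓ)
    (ht : t ≤ m + n + (⌈6 * ℓ / Λ⌉₊ : ℝ) *
      (8 * N + 40 * ((⌈608 * (N : ℝ) / (m + n)⌉₊ : ℝ) * (m + n)) + 30 * (m + n))) :
    t ≤ 24470 * N + 146808 * (N / Λ * ℓ) := by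
  have hm' : (0 : ℝ) < m := by exact_mod_cast hm
  have hmn' : (m : ℝ) + n ≤ 2 * N := by exact_mod_cast hmn
  have h0 : (0 : ℝ) < m + n := by positivity
  have hT := (Nat.ceil_lt_add_one (show 0 ≤ 608 * (N : ℝ) / (m + n) by positivity)).le
  have hK := (Nat.ceil_lt_add_one (show 0 ≤ 6 * ℓ / Λ by positivity)).le
  have hT2 := mul_le_mul_of_nonneg_right hT h0.le
  have e1 : (608 * (N : ℝ) / (m + n) + 1) * (m + n) = 608 * N + (m + n) := by field_simp
  rw [e1] at hT2
  -- `8 + 40 * 608 + 70 * 2 = 24468`, using `m + n ≤ 2 * N`.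
  have h1 : 8 * (N : ℝ) + 40 * ((⌈608 * (N : ℝ) / (m + n)⌉₊ : ℝ) * (m + n)) + 30 * (m + n) ≤
      24468 * N := by linarith
  have h2 := mul_le_mul hK h1 (by positivity) (by positivity)
  have e2 : (6 * ℓ / Λ + 1) * (24468 * (N : ℝ)) = 146808 * (N / Λ * ℓ) + 24468 * N := by
    field_simp
    ring
  linarith

/-- From `log (1 + s) ≥ s / (1 + s)` with `s = N / X ≤ 1`. -/
theorem div_log_le {N X : ℝ} (hN : 0 < N) (hNX : N ≤ X) : N / Real.log (1 + N / X) ≤ 2 * X := by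
  have hX : 0 < X := hN.trans_le hNX
  have hd : 0 < N / X := by positivity
  have h := Real.one_sub_inv_le_log_of_pos (show 0 < 1 + N / X by positivity)
  have e : 1 - (1 + N / X)⁻¹ = N / (X + N) := by field_simp; ring
  rw [e] at h
  have h1 : N / (2 * X) ≤ N / (X + N) := by gcongr; linarith
  have h2 : 0 < N / (2 * X) := by positivity
  rw [div_le_iff₀ (by linarith)]
  calc N = 2 * X * (N / (2 * X)) := by field_simp
    _ ≤ _ := mul_le_mul_of_nonneg_left (h1.trans h) (by positivity)

/-- The accuracy reached after the chosen number of outer iterations. -/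
theorem contraction_bound {G Θ ε ℓ Λ : ℝ} {K : ℕ} (hG : 0 < G) (hΘ : 0 ≤ Θ) (hε : 0 < ε)
    (hΛ : 0 < Λ) (hℓ1 : 1 ≤ ℓ) (hℓ : Real.log (G * √Θ / ε) ≤ ℓ) (hK : 6 * ℓ / Λ ≤ K) :
    8 * G ^ 2 * Θ / ε * Real.exp (-Λ) ^ K ≤ ε / 2 := by
  rw [← Real.exp_nat_mul]
  have h1 : Real.exp (K * -Λ) ≤ Real.exp (-(6 * ℓ)) := by
    rw [Real.exp_le_exp]
    have := (div_le_iff₀ hΛ).1 hK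
    linarith
  have h2 : G * √Θ ≤ ε * Real.exp ℓ := by
    -- `Θ = 0` does occur, for two one-point simplices; the logarithm then carries no information.
    rcases (mul_nonneg hG.le (Real.sqrt_nonneg Θ)).eq_or_lt with h | h
    · rw [← h]; positivity
    · rw [Real.log_le_iff_le_exp (by positivity), div_le_iff₀ hε] at hℓ
      linarith
  have h3 : G ^ 2 * Θ ≤ ε ^ 2 * Real.exp ℓ ^ 2 := by
    have := pow_le_pow_left₀ (mul_nonneg hG.le (Real.sqrt_nonneg Θ)) h2 2
    rwa [mul_pow, mul_pow, Real.sq_sqrt hΘ] at this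
  have h4 : (2 : ℝ) ≤ Real.exp ℓ := by linarith [Real.add_one_le_exp ℓ]
  have e1 : Real.exp (-(6 * ℓ)) = 1 / Real.exp ℓ ^ 6 := by
    rw [Real.exp_neg, one_div, ← Real.exp_nat_mul]
    norm_num
  rw [e1] at h1
  have hE := Real.exp_pos ℓ
  -- Two of the six factors `exp (-ℓ)` turn `G ^ 2 * Θ` into `ε ^ 2`; the other four beat the
  -- constant `8` down to `1 / 2`.
  have h5 : (16 : ℝ) ≤ Real.exp ℓ ^ 4 := by
    have := pow_le_pow_left₀ zero_le_two h4 4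
    linarith
  calc 8 * G ^ 2 * Θ / ε * Real.exp (K * -Λ)
      ≤ 8 * (ε ^ 2 * Real.exp ℓ ^ 2) / ε * (1 / Real.exp ℓ ^ 6) := by
        rw [mul_assoc 8]
        gcongr
    _ = 8 * ε / Real.exp ℓ ^ 4 := by field_simp
    _ ≤ ε / 2 := by
        rw [div_le_iff₀ (by positivity)]
        nlinarith

end

theorem sqrt_mul_mul_sqrt_div {x y : ℝ} (hx : 0 < x) (hy : 0 < y) :
    √(x * y) * √(x / y) = x := by
  rw [← Real.sqrt_mul (by positivity)]
  have : x * y * (x / y) = x ^ 2 := by field_simp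
  rw [this, Real.sqrt_sq hx.le]

theorem one_div_sqrt_div {x y : ℝ} : 1 / √(x / y) = √(y / x) := by
  rw [one_div, ← Real.sqrt_inv, inv_div]

end SaddleVR

/-! ### Assembly of the main theorem. -/

open SaddleVR

/-- There are a universal constant `C` and a rule `par` choosing the parameters of the algorithm
from the scalar characteristics of the problem, such that the output has expected gap at most `ε`
and the running time bound holds. -/
theorem mainTheorem9 :
    ∃ C : ℝ, 0 < C ∧
    ∃ par : Setup → (n m N : ℕ) → (L μx μy B ε : ℝ) → Params,
    ∀ (S : Setup) (n m : ℕ) (P : Problem n m) (μx μy B ε : ℝ),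
      0 < n → 0 < m → m + n ≤ 2 * nnz P.A →
      0 < μx → 0 < μy → 0 < B → 0 < ε →
      IsCompositeTerm S.xBlock P.φ P.gradφ μx →
      IsCompositeTerm S.yBlock P.ψ P.gradψ μy →
      P.LinearGrowth S B →
      ∀ (L : ℝ) (N : ℕ) (q : Params), L = S.matConst P.A → N = nnz P.A →
        q = par S n m N L μx μy B ε →
        0 < q.α ∧ 0 < q.η ∧ 1 ≤ q.T ∧
        (P.fullLoop S μx μy q).Always
          (fun z => z.1 ∈ S.xBlock.dom n ∧ z.2 ∈ S.yBlock.dom m) ∧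
        (P.fullLoop S μx μy q).mean (P.gap S) ≤ ε ∧
        ((P.fullLoop S μx μy q).time : ℝ) ≤
          C * (N + N / Real.log (1 + N / condTerm n m N L μx μy) *
            logFactor L B (S.range n m) μx μy ε) ∧
        ((N : ℝ) ≤ condTerm n m N L μx μy →
          ((P.fullLoop S μx μy q).time : ℝ) ≤
            C * (N + condTerm n m N L μx μy * logFactor L B (S.range n m) μx μy ε)) := by
  -- The constant exceeds `2 * 146808`, as needed when `X ≥ N`, where `div_log_le` loses a factor
  -- `2`.
  refine ⟨300000, by norm_num, chosenParams, ?_⟩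
  intro S n m P μx μy B ε hn hm hmn hμx hμy hB hε hφ hψ hgrow L N q hL hN hq
  have hN0 : 0 < N := by omega
  rw [← hN] at hmn
  have hL0 : 0 < L := hL ▸ matConst_pos S (hN ▸ hN0)
  have hN' : (0 : ℝ) < N := by exact_mod_cast hN0
  have hm' : (0 : ℝ) < m := by exact_mod_cast hm
  have hmn' : (0 : ℝ) < m + n := by positivity
  have hα_eq : q.α = L * √((m + n) / N) := by rw [hq]; rfl
  have hη_eq : q.η = q.α / (96 * L ^ 2) := by rw [hq]; rfl
  have hT_eq : q.T = ⌈608 * (N : ℝ) / (m + n)⌉₊ := by rw [hq]; rfl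
  have hK_eq : q.K = ⌈6 * logFactor L B (S.range n m) μx μy ε /
    Real.log (1 + N / condTerm n m N L μx μy)⌉₊ := by rw [hq]; rfl
  have hα : 0 < q.α := by rw [hα_eq]; positivity
  have hη : 0 < q.η := by rw [hη_eq]; positivity
  have hT : 1 ≤ q.T := by rw [hT_eq]; exact Nat.ceil_pos.2 (by positivity)
  set μ := √(μx * μy) with hμ_def
  set ρ := √(μx / μy) with hρ_def
  have hμ : 0 < μ := Real.sqrt_pos.2 (by positivity)
  have hρ : 0 < ρ := Real.sqrt_pos.2 (by positivity)
  set X := condTerm n m N L μx μy with hX_def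
  set ℓ := logFactor L B (S.range n m) μx μy ε with hℓ_def
  set Λ := Real.log (1 + N / X) with hΛ_def
  have hX : N / X = μ / q.α := by
    rw [hX_def, condTerm_eq hN0, ← hα_eq, ← hμ_def]
    field_simp
  have hratio : 0 < N / X := by rw [hX]; positivity
  have hΛ : 0 < Λ := Real.log_pos (by linarith)
  have hℓ : 1 ≤ ℓ := le_max_left _ _
  have htime : ((P.fullLoop S μx μy q).time : ℝ) ≤ 24470 * N + 146808 * (N / Λ * ℓ) := by
    refine time_bound hm hmn hΛ (by linarith) ?_
    have := P.time_fullLoop_le S q hm μx μy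
    rw [← hN, hT_eq, hK_eq] at this
    exact_mod_cast this
  have hstep : ∀ z, (P.outerStep S q μ ρ z).Always (Problem.InCore S) :=
    Problem.always_outerStep hn hm hρ hα hμ
  refine ⟨hα, hη, hT, ?_, ?_, ?_, fun hNX => ?_⟩
  · exact (Comp.always_iterate (fun z _ => hstep z) q.K
      (Problem.inCore_start hn hm)).mono fun z hz => hz.inDom
  · obtain ⟨zs, hzs, hsad⟩ := Problem.exists_saddle (hφ.isConvexTerm hμx.le)
      (hψ.isConvexTerm hμy.le) hn hm
    have hμρ : μ * ρ = μx := sqrt_mul_mul_sqrt_div hμx hμy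
    have hμρ' : μ * (1 / ρ) = μy := by
      rw [hμ_def, hρ_def, one_div_sqrt_div, mul_comm μx]
      exact sqrt_mul_mul_sqrt_div hμy hμx
    have hTα : 608 * S.matConst P.A ^ 2 ≤ q.T * q.α ^ 2 := by
      have h1 : 608 * (N : ℝ) / (m + n) ≤ q.T := by rw [hT_eq]; exact Nat.le_ceil _
      rw [← hL]
      calc 608 * L ^ 2 = 608 * (N : ℝ) / (m + n) * q.α ^ 2 := by
            rw [hα_eq, mul_pow, Real.sq_sqrt (by positivity)]
            field_simp
        _ ≤ _ := mul_le_mul_of_nonneg_right h1 (sq_nonneg _)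
    have hηL : q.η * (96 * S.matConst P.A ^ 2) = q.α := by
      rw [← hL, hη_eq]
      field_simp
    set κ := ρ + 1 / ρ with hκ
    have hκ0 : 0 < κ := by positivity
    have hΘ : 0 ≤ S.range n m :=
      (add_nonneg (Problem.rangeConst_nonneg _ _) (Problem.rangeConst_nonneg _ _)).trans
        (Problem.rangeConst_add_le S hn hm)
    have h := Problem.mean_iterate_outerStep_le hφ hψ hμx.le hμy.le hn hm hρ hα hμ hμρ hμρ' hη hηL
      hT hTα hzs hsad (a := 8 * (B + L) ^ 2 * κ / ε) (by positivity) (ε / 2) (f := P.gap S)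
      (fun z hz => by
        rw [hL]
        exact Problem.gap_le_div hB hgrow hzs hsad hρ hε hz) q.K (Problem.inCore_start hn hm)
    refine h.trans ?_
    -- Since `N / X = μ / α`, the contraction factor is exactly `1 / (1 + N / X)`.
    have e1 : q.α / (q.α + μ) = Real.exp (-Λ) := by
      rw [Real.exp_neg, hΛ_def, Real.exp_log (by linarith), hX]
      field_simp
    have h2 := contraction_bound (G := B + L) (Θ := κ ^ 2 * S.range n m) (K := q.K) (by positivity)
      (by positivity) hε hΛ hℓ
      (by
        rw [hℓ_def, hκ, hρ_def, one_div_sqrt_div]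
        exact le_max_right _ _)
      (by rw [hK_eq]; exact Nat.le_ceil _)
    have h3 := Problem.div_start_le hn hm hρ hzs
    rw [e1]
    have h4 : 8 * (B + L) ^ 2 * κ / ε * Real.exp (-Λ) ^ q.K *
        Problem.div S ρ (Problem.start S) zs ≤
        8 * (B + L) ^ 2 * (κ ^ 2 * S.range n m) / ε * Real.exp (-Λ) ^ q.K := by
      refine (mul_le_mul_of_nonneg_left h3 (by positivity)).trans_eq ?_
      ring
    linarith
  · have h0 : 0 ≤ N / Λ * ℓ := by positivity
    linarith
  · have h1 := mul_le_mul_of_nonneg_right (div_log_le hN' hNX) (zero_le_one.trans hℓ)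
    have h0 : 0 ≤ X * ℓ := mul_nonneg (hN'.le.trans hNX) (zero_le_one.trans hℓ)
    linarith
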